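/- Let $d\ge 1$ be an integer, let $\Delta\ge 0$ be real, and put $s=\lfloor\Delta\rfloor+1$. For a positive integer $n$ let $$p_d(n,\Delta)=\sup_{V,B}\ \mathbf P\bigl(\xi_1v_1+\dots+\xi_nv_n\in B\bigr),$$ where $\xi_1,\dots,\xi_n$ are i.i.d. Bernoulli random variables, each taking the values $1$ and $-1$ with probability $1/2$, and the supremum is taken over all families $V=(v_1,\dots,v_n)$ of $n$ vectors in $\mathbb R^d$ (repetitions allowed) of Euclidean length at least $1$ and all closed balls $B\subset\mathbb R^d$ of radius $\Delta$. Let $S(n,m)$ denote the sum of the largest $m$ of the binomial coefficients $\binom ni$, $0\le i\le n$ (of all of them if $m>n+1$). If $s-1\le\Delta<\sqrt{(s-1)^2+1}$, then there is $n_0=n_0(d,\Delta)$ such that for all $n\ge n_0$, $$p_d(n,\Delta)=2^{-n}S(n,s).$$ -/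

import Mathlib

open MeasureTheory ProbabilityTheory Filter

namespace LittlewoodOfford

/-- The joint law on `ℝⁿ` of `n` i.i.d. Bernoulli signs `ξ₁, …, ξₙ`, each of them equal to
`1` or `-1` with probability `1/2` each. -/
noncomputable def signLaw (n : ℕ) : Measure (Fin n → ℝ) :=
  Measure.pi fun _ => bernoulliMeasure (1 : ℝ) (-1) ⟨1 / 2, by norm_num, by norm_num⟩

/-- The probability that the random sum `X_V = ξ₁ v₁ + ⋯ + ξₙ vₙ` lies in the set `B`. -/
noncomputable def sumProb {d n : ℕ} (v : Fin n → EuclideanSpace ℝ (Fin d))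
    (B : Set (EuclideanSpace ℝ (Fin d))) : ℝ :=
  (signLaw n).real {ξ | ∑ i, ξ i • v i ∈ B}

/-- The small ball probability `p_d(n, Δ)`: the supremum of `P(X_V ∈ B)` over all families `V`
of `n` vectors of length at least one in `ℝᵈ` and all closed balls `B` of radius `Δ`. -/
noncomputable def smallBallProb (d n : ℕ) (Δ : ℝ) : ℝ :=
  sSup {p : ℝ | ∃ (v : Fin n → EuclideanSpace ℝ (Fin d)) (x : EuclideanSpace ℝ (Fin d)),
    (∀ i, 1 ≤ ‖v i‖) ∧ p = sumProb v (Metric.closedBall x Δ)}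

/-- `S(n, m)`: the sum of the largest `m` binomial coefficients `n.choose i`, `0 ≤ i ≤ n`
(of all of them if `m > n + 1`), written as the largest sum of at most `m` of them. -/
def largestBinomSum (n m : ℕ) : ℕ :=
  ((Finset.range (n + 1)).powerset.filter fun T => T.card ≤ m).sup
    fun T => ∑ i ∈ T, n.choose i

end LittlewoodOfford

/-!
A signed sum is, up to translation and scaling, a subset sum, so the claim concerns the number of
sets `A ⊆ {1, …, n}` whose subset sum `∑ i ∈ A, v i` lies in a ball of radius `r = Δ / 2`. Equal unit
vectors give the lower bound. The upper bound rests on one combinatorial tool, a weighted LYM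
inequality (`sum_div_choose_le_of_isChain`): if nonnegative weights on subsets have total at most `W`
on every chain, then their total is at most `W` times the middle binomial coefficient; the version for
indicator functions, with the rearrangement of binomial coefficients, gives `S(n, s)`. No Fourier
analysis is needed.

Cover the unit sphere by finitely many small cells and choose a popular cell, with centre `e`. There
are three cases.

* Some cell whose direction is transversal to `e` also holds a positive proportion of the vectors.
  Then a product of two chains, one in each cell, meets the ball boundedly often, and the product
  form of the LYM inequality gives the bound `O(1 / n)`, which is negligible
  (`hitProb_union_le_mul_middleProb`).
* Almost all the vectors are nearly parallel to `e`, and `∑ i ∈ U, sin² θ i ≤ 1` for every set `U` of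
  at most `s + 1` indices, where `θ i` is the angle between `v i` and the line of `e`. After
  reversing vectors, all of them lie in one half-space, and
  `⟪v i, v j⟫ ≥ 1 - sin² θ i - sin² θ j`; hence a sum of `s` or more vectors has squared length at
  least `(s - 1) ^ 2 + 1 > Δ ^ 2`. So a chain has at most `s` hits, and the count is at most
  `S(n, s)` exactly (`card_hits_le_largestBinomSum`).
* Almost all the vectors are nearly parallel to `e`, but some `U` violates this. Condition on which
  of the boundedly many indices of `U` belong to `A`: the ball is then translated by the subset sums
  of `U`, and some two translates have centres whose components orthogonal to `e` are at distance
  more than `1`, up to small errors. A chain of nearly parallel vectors has `s` hits only in a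
  translate whose centre it passes at distance at most `√(Δ ^ 2 - (s - 1) ^ 2) / 2 < 1 / 2`, up to
  small errors, so at least one of the translates gets at most `s - 1` hits
  (`exists_card_filter_hits_lt`). This lowers the leading constant `s` by a fixed amount
  (`hitProb_union_le`), which outweighs the loss from the few vectors outside the main cone.
-/

namespace LittlewoodOfford

/-! ### Weighted LYM inequalities -/

/-- The LYM inequality with weights: it suffices to bound the weight of every chain. Splitting off
the top element `G` and averaging over the subsets `G.erase x` reduces `G` to a smaller set, since
a chain in `G.erase x` can be prolonged by `G`. -/
theorem sum_div_choose_le_of_isChain {α : Type*} [DecidableEq α] (G : Finset α)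
    (f : Finset α → ℝ) (W : ℝ)
    (h : ∀ C : Finset (Finset α), C ⊆ G.powerset → IsChain (· ⊆ ·) (C : Set (Finset α)) →
      ∑ A ∈ C, f A ≤ W) :
    ∑ A ∈ G.powerset, f A / (G.card.choose A.card : ℝ) ≤ W := by
  induction hm : G.card generalizing G W with
  | zero =>
    obtain rfl := Finset.card_eq_zero.1 hm
    simpa using h {∅} (by simp) (by simp)
  | succ m ih =>
    have hm0 : (0 : ℝ) < m + 1 := by positivity
    have hx : ∀ x ∈ G, ∑ A ∈ (G.erase x).powerset, f A / (m.choose A.card : ℝ) ≤ W - f G := by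
      intro x hx
      refine ih (G.erase x) (W - f G) ?_ (by rw [Finset.card_erase_of_mem hx, hm]; rfl)
      intro C hC hchain
      have hsub : ∀ A ∈ C, A ⊆ G := fun A hA =>
        (Finset.mem_powerset.1 (hC hA)).trans (Finset.erase_subset _ _)
      have hG : G ∉ C := fun hG => by
        have := Finset.mem_powerset.1 (hC hG) hx
        simp at this
      have := h (insert G C) (by
        intro A hA
        rcases Finset.mem_insert.1 hA with rfl | hA
        · simp
        · exact Finset.mem_powerset.2 (hsub A hA)) (by
        rw [Finset.coe_insert]
        exact hchain.insert fun A hA _ => Or.inr (hsub A hA))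
      rw [Finset.sum_insert hG] at this
      linarith
    have hterm : ∀ A ∈ G.ssubsets, f A / ((m + 1).choose A.card : ℝ)
        = ∑ x ∈ G \ A, f A / (m.choose A.card : ℝ) / (m + 1) := by
      intro A hA
      have hA' := Finset.mem_ssubsets.1 hA
      have hlt : A.card < m + 1 := hm ▸ Finset.card_lt_card hA'
      rw [Finset.sum_const, Finset.card_sdiff_of_subset hA'.1, hm, nsmul_eq_mul,
        Nat.cast_sub hlt.le]
      have h1 : ((m.choose A.card : ℝ)) * (m + 1)
          = ((m + 1).choose A.card : ℝ) * ((m + 1 : ℕ) - A.card) := by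
        rw [← Nat.cast_sub hlt.le]
        exact_mod_cast Nat.choose_mul_succ_eq m A.card
      have h2 : (0 : ℝ) < m.choose A.card := by
        exact_mod_cast Nat.choose_pos (Nat.lt_succ_iff.1 hlt)
      have h3 : (0 : ℝ) < (m + 1).choose A.card := by
        exact_mod_cast Nat.choose_pos hlt.le
      rw [div_div, h1]
      have h4 : (((m + 1 : ℕ) : ℝ) - A.card) ≠ 0 := by
        rw [← Nat.cast_sub hlt.le]
        exact_mod_cast (Nat.sub_pos_of_lt hlt).ne'
      field_simp
    have hpow : G.powerset = insert G G.ssubsets := by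
      rw [Finset.ssubsets, Finset.insert_erase (Finset.mem_powerset_self G)]
    rw [hpow, Finset.sum_insert (by simp), Finset.sum_congr rfl hterm,
      Finset.sum_comm' (t' := G) (s' := fun x => (G.erase x).powerset)]
    · have : ∑ x ∈ G, ∑ A ∈ (G.erase x).powerset, f A / (m.choose A.card : ℝ) / (m + 1)
          ≤ ∑ x ∈ G, (W - f G) / (m + 1) := by
        refine Finset.sum_le_sum fun x hx' => ?_
        rw [← Finset.sum_div]
        exact div_le_div_of_nonneg_right (hx x hx') hm0.le
      rw [Finset.sum_const, hm, nsmul_eq_mul] at this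
      have h5 : ((m + 1 : ℕ) : ℝ) * ((W - f G) / (m + 1)) = W - f G := by
        push_cast; field_simp
      rw [h5] at this
      simp only [hm, Nat.choose_self, Nat.cast_one, div_one]
      linarith
    · intro A x
      simp only [Finset.mem_ssubsets, Finset.mem_sdiff, Finset.mem_powerset]
      constructor
      · rintro ⟨hA, hxG, hxA⟩
        exact ⟨Finset.subset_erase.2 ⟨hA.1, hxA⟩, hxG⟩
      · rintro ⟨hA, hxG⟩
        obtain ⟨h1, h2⟩ := Finset.subset_erase.1 hA
        exact ⟨⟨h1, fun h => h2 (h hxG)⟩, hxG, h2⟩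

theorem sum_le_choose_middle_mul_of_isChain {α : Type*} [DecidableEq α] (G : Finset α)
    (f : Finset α → ℝ) (hf : ∀ A, 0 ≤ f A) (W : ℝ)
    (h : ∀ C : Finset (Finset α), C ⊆ G.powerset → IsChain (· ⊆ ·) (C : Set (Finset α)) →
      ∑ A ∈ C, f A ≤ W) :
    ∑ A ∈ G.powerset, f A ≤ (G.card.choose (G.card / 2) : ℝ) * W := by
  refine le_trans ?_ (mul_le_mul_of_nonneg_left
    (sum_div_choose_le_of_isChain G f W h) (Nat.cast_nonneg _))
  rw [Finset.mul_sum]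
  refine Finset.sum_le_sum fun A hA => ?_
  have hc := Finset.card_le_card (Finset.mem_powerset.1 hA)
  have h1 : (0 : ℝ) < G.card.choose A.card := by exact_mod_cast Nat.choose_pos hc
  have h2 : (G.card.choose A.card : ℝ) ≤ G.card.choose (G.card / 2) := by
    exact_mod_cast Nat.choose_le_middle _ _
  rw [mul_div_assoc', le_div_iff₀ h1, mul_comm]
  exact mul_le_mul_of_nonneg_right h2 (hf A)

/-- The version for products of two chains follows by applying the one-chain version in each
variable. -/
theorem sum_sum_le_choose_middle_mul_of_isChain {α β : Type*} [DecidableEq α] [DecidableEq β]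
    (G : Finset α) (H : Finset β)
    (f : Finset α → Finset β → ℝ) (hf : ∀ A B, 0 ≤ f A B) (W : ℝ)
    (h : ∀ C : Finset (Finset α), C ⊆ G.powerset → IsChain (· ⊆ ·) (C : Set (Finset α)) →
      ∀ D : Finset (Finset β), D ⊆ H.powerset → IsChain (· ⊆ ·) (D : Set (Finset β)) →
      ∑ A ∈ C, ∑ B ∈ D, f A B ≤ W) :
    ∑ A ∈ G.powerset, ∑ B ∈ H.powerset, f A B
      ≤ (G.card.choose (G.card / 2) : ℝ) * ((H.card.choose (H.card / 2) : ℝ) * W) := by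
  refine sum_le_choose_middle_mul_of_isChain G _
    (fun A => Finset.sum_nonneg fun B _ => hf A B) _ fun C hC hCc => ?_
  rw [Finset.sum_comm]
  refine sum_le_choose_middle_mul_of_isChain H _
    (fun B => Finset.sum_nonneg fun A _ => hf A B) _ fun D hD hDc => ?_
  rw [Finset.sum_comm]
  exact h C hC hCc D hD hDc

/-- The members of a chain have distinct cardinalities, so its least and its greatest member differ
by at least as many elements as the chain has steps. -/
theorem exists_subset_card_le_card_sdiff_add_one {α : Type*} [DecidableEq α]
    {C : Finset (Finset α)} (hC : IsChain (· ⊆ ·) (C : Set (Finset α))) (hne : C.Nonempty) :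
    ∃ A ∈ C, ∃ A' ∈ C, A ⊆ A' ∧ C.card ≤ (A' \ A).card + 1 := by
  obtain ⟨A, hA, hAmin⟩ := C.exists_min_image Finset.card hne
  obtain ⟨A', hA', hAmax⟩ := C.exists_max_image Finset.card hne
  have hsub : A ⊆ A' := by
    rcases hC.total hA hA' with h | h
    · exact h
    · exact (Finset.eq_of_subset_of_card_le h (hAmin A' hA')).symm ▸ subset_rfl
  refine ⟨A, hA, A', hA', hsub, ?_⟩
  have hinj : Set.InjOn Finset.card (C : Set (Finset α)) := by
    intro B hB B' hB' hcard
    rcases hC.total hB hB' with h | h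
    · exact Finset.eq_of_subset_of_card_le h hcard.ge
    · exact (Finset.eq_of_subset_of_card_le h hcard.le).symm
  rw [← Finset.card_image_of_injOn hinj, Finset.card_sdiff_of_subset hsub]
  have : C.image Finset.card ⊆ Finset.Icc A.card A'.card := by
    intro k hk
    obtain ⟨B, hB, rfl⟩ := Finset.mem_image.1 hk
    exact Finset.mem_Icc.2 ⟨hAmin B hB, hAmax B hB⟩
  have := Finset.card_le_card this
  have hle := Finset.card_le_card hsub
  rw [Nat.card_Icc] at this
  omega

/-! ### Central binomial coefficients -/

theorem choose_le_choose_of_le_half {n a b : ℕ} (hab : a ≤ b) (hb : b ≤ n / 2) :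
    n.choose a ≤ n.choose b := by
  induction b, hab using Nat.le_induction with
  | base => exact le_rfl
  | succ b _ ih =>
    exact (ih (by omega)).trans (Nat.choose_le_succ_of_lt_half_left (by omega))

theorem choose_le_choose_of_min_le {n k l : ℕ} (hl : l ≤ n) (hk : k ≤ n)
    (h : min l (n - l) ≤ min k (n - k)) : n.choose l ≤ n.choose k := by
  have key : ∀ j ≤ n, n.choose j = n.choose (min j (n - j)) := by
    intro j hj
    rcases le_total j (n - j) with h | h
    · rw [min_eq_left h]
    · rw [min_eq_right h, Nat.choose_symm hj]
  rw [key l hl, key k hk]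
  exact choose_le_choose_of_le_half h (by omega)

/-- The `s` consecutive indices placed symmetrically (up to rounding) about `n / 2`. -/
def centralWindow (n s : ℕ) : Finset ℕ := Finset.Ico ((n + 1 - s) / 2) ((n + 1 - s) / 2 + s)

theorem card_centralWindow (n s : ℕ) : (centralWindow n s).card = s := by
  simp [centralWindow]

theorem le_of_mem_centralWindow {n s k : ℕ} (hs : s ≤ n) (hk : k ∈ centralWindow n s) :
    k ≤ n := by
  have := Finset.mem_Ico.1 hk
  omega

theorem choose_le_choose_of_mem_centralWindow {n s k l : ℕ} (hs : s ≤ n)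
    (hk : k ∈ centralWindow n s) (hl : l ≤ n) (hl' : l ∉ centralWindow n s) :
    n.choose l ≤ n.choose k := by
  have hk' := Finset.mem_Ico.1 hk
  have hl'' : ¬ (_ ∧ _) := fun h => hl' (Finset.mem_Ico.2 h)
  exact choose_le_choose_of_min_le hl (by omega) (by omega)

/-- Fractional knapsack: weights `a k ∈ [0, 1]` of total mass at most `s` are best placed on
the central window. -/
theorem sum_mul_choose_le_sum_centralWindow {n s : ℕ} (hs1 : 1 ≤ s) (hs : s ≤ n) (a : ℕ → ℝ)
    (h0 : ∀ k, 0 ≤ a k) (h1 : ∀ k, a k ≤ 1) (hsum : ∑ k ∈ Finset.range (n + 1), a k ≤ s) :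
    ∑ k ∈ Finset.range (n + 1), a k * (n.choose k : ℝ)
      ≤ ∑ k ∈ centralWindow n s, (n.choose k : ℝ) := by
  have hne : (centralWindow n s).Nonempty := by
    rw [← Finset.card_pos, card_centralWindow]; exact hs1
  obtain ⟨k0, hk0, hmin⟩ := (centralWindow n s).exists_min_image (fun k => n.choose k) hne
  have hsub : centralWindow n s ⊆ Finset.range (n + 1) := fun k hk =>
    Finset.mem_range.2 (Nat.lt_succ_iff.2 (le_of_mem_centralWindow hs hk))
  rw [← Finset.sum_sdiff hsub] at hsum ⊢
  -- `t` separates the binomial coefficients inside the window from those outside.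
  set t : ℝ := (n.choose k0 : ℝ)
  have hout : ∑ k ∈ Finset.range (n + 1) \ centralWindow n s, a k * (n.choose k : ℝ)
      ≤ ∑ k ∈ Finset.range (n + 1) \ centralWindow n s, a k * t := by
    refine Finset.sum_le_sum fun k hk => mul_le_mul_of_nonneg_left ?_ (h0 k)
    obtain ⟨hk1, hk2⟩ := Finset.mem_sdiff.1 hk
    exact Nat.cast_le.2 (choose_le_choose_of_mem_centralWindow hs hk0
      (Nat.lt_succ_iff.1 (Finset.mem_range.1 hk1)) hk2)
  have hin : ∑ k ∈ centralWindow n s, (1 - a k) * t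
      ≤ ∑ k ∈ centralWindow n s, (1 - a k) * (n.choose k : ℝ) := by
    refine Finset.sum_le_sum fun k hk => mul_le_mul_of_nonneg_left ?_ (by linarith [h1 k])
    exact Nat.cast_le.2 (hmin k hk)
  rw [← Finset.sum_mul] at hout hin
  simp only [sub_mul, one_mul, Finset.sum_sub_distrib, Finset.sum_const, card_centralWindow,
    nsmul_eq_mul, mul_one] at hin
  have ht : 0 ≤ t := Nat.cast_nonneg _
  nlinarith

theorem largestBinomSum_eq_sum_centralWindow {n s : ℕ} (hs1 : 1 ≤ s) (hs : s ≤ n) :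
    largestBinomSum n s = ∑ k ∈ centralWindow n s, n.choose k := by
  apply le_antisymm
  · refine Finset.sup_le fun T hT => ?_
    obtain ⟨hT1, hT2⟩ := Finset.mem_filter.1 hT
    have hT1 := Finset.mem_powerset.1 hT1
    have hcast := sum_mul_choose_le_sum_centralWindow hs1 hs (fun k => if k ∈ T then 1 else 0)
      (fun k => by split_ifs <;> norm_num) (fun k => by split_ifs <;> norm_num) (by
        rw [Finset.sum_ite_mem, Finset.inter_eq_right.2 hT1]
        simpa using hT2)
    simp only [ite_mul, one_mul, zero_mul] at hcast
    rw [Finset.sum_ite_mem, Finset.inter_eq_right.2 hT1] at hcast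
    exact_mod_cast hcast
  · refine Finset.le_sup (f := fun T => ∑ i ∈ T, n.choose i) (Finset.mem_filter.2 ⟨?_, ?_⟩)
    · exact Finset.mem_powerset.2 fun k hk =>
        Finset.mem_range.2 (Nat.lt_succ_iff.2 (le_of_mem_centralWindow hs hk))
    · exact (card_centralWindow n s).le

/-- A family of subsets of `G` which meets every chain in at most `s` members has at most
`S(|G|, s)` members. -/
theorem card_le_largestBinomSum_of_isChain {α : Type*} [DecidableEq α] (G : Finset α)
    {s : ℕ} (hs1 : 1 ≤ s) (hs : s ≤ G.card) (F : Finset (Finset α)) (hF : F ⊆ G.powerset)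
    (h : ∀ C ⊆ F, IsChain (· ⊆ ·) (C : Set (Finset α)) → C.card ≤ s) :
    F.card ≤ largestBinomSum G.card s := by
  have hlym := sum_div_choose_le_of_isChain G (fun A => if A ∈ F then 1 else 0) s (by
    intro C _ hCc
    rw [Finset.sum_ite_mem, Finset.sum_const, nsmul_eq_mul, mul_one]
    exact_mod_cast h (C ∩ F) Finset.inter_subset_right
      (hCc.mono (by simp [Set.inter_subset_left])))
  have hmap : ∀ A ∈ F, A.card ∈ Finset.range (G.card + 1) := fun A hA =>
    Finset.mem_range.2 (Nat.lt_succ_iff.2 (Finset.card_le_card (Finset.mem_powerset.1 (hF hA))))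
  have hlev : ∀ k, F.filter (fun A => A.card = k) ⊆ G.powersetCard k := by
    intro k A hA
    obtain ⟨hA, hk⟩ := Finset.mem_filter.1 hA
    exact Finset.mem_powersetCard.2 ⟨Finset.mem_powerset.1 (hF hA), hk⟩
  have hlevc : ∀ k, (F.filter (fun A => A.card = k)).card ≤ G.card.choose k := fun k => by
    simpa using Finset.card_le_card (hlev k)
  have hknap := sum_mul_choose_le_sum_centralWindow hs1 hs
    (fun k => ((F.filter (fun A => A.card = k)).card : ℝ) / (G.card.choose k : ℝ))
    (fun k => by positivity) (fun k => by
      refine div_le_one_of_le₀ ?_ (Nat.cast_nonneg _)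
      exact_mod_cast hlevc k) (by
      refine le_trans (le_of_eq ?_) hlym
      simp only [ite_div, zero_div]
      rw [Finset.sum_ite_mem, Finset.inter_eq_right.2 hF,
        ← Finset.sum_fiberwise_of_maps_to hmap]
      refine Finset.sum_congr rfl fun k _ => ?_
      rw [Finset.sum_congr rfl (g := fun _ => 1 / (G.card.choose k : ℝ))]
      · rw [Finset.sum_const, nsmul_eq_mul, mul_one_div]
      · intro A hA
        rw [(Finset.mem_filter.1 hA).2])
  rw [largestBinomSum_eq_sum_centralWindow hs1 hs]
  have hF' : (F.card : ℝ) = ∑ k ∈ Finset.range (G.card + 1),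
      ((F.filter (fun A => A.card = k)).card : ℝ) / (G.card.choose k : ℝ)
        * (G.card.choose k : ℝ) := by
    rw [Finset.card_eq_sum_card_fiberwise hmap]
    push_cast
    refine Finset.sum_congr rfl fun k hk => ?_
    have : (G.card.choose k : ℝ) ≠ 0 := by
      exact_mod_cast (Nat.choose_pos (Nat.lt_succ_iff.1 (Finset.mem_range.1 hk))).ne'
    field_simp
  exact_mod_cast hF'.le.trans hknap

/-- The largest point probability `C(m, ⌊m/2⌋) / 2 ^ m` of a symmetric binomial law. -/
noncomputable def middleProb (m : ℕ) : ℝ := (m.choose (m / 2) : ℝ) / 2 ^ m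

theorem middleProb_pos (m : ℕ) : 0 < middleProb m := by
  have : 0 < m.choose (m / 2) := Nat.choose_pos (Nat.div_le_self _ _)
  unfold middleProb
  positivity

theorem middleProb_eq_centralBinom (m : ℕ) :
    middleProb m = (Nat.centralBinom ((m + 1) / 2) : ℝ) / 4 ^ ((m + 1) / 2) := by
  obtain ⟨k, rfl | rfl⟩ := Nat.even_or_odd' m
  · have h1 : (2 * k + 1) / 2 = k := by omega
    have h2 : 2 * k / 2 = k := by omega
    rw [middleProb, h1, h2, Nat.centralBinom_eq_two_mul_choose, pow_mul]
    norm_num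
  · have h1 : (2 * k + 1 + 1) / 2 = k + 1 := by omega
    have h2 : (2 * k + 1) / 2 = k := by omega
    rw [middleProb, h1, h2, Nat.centralBinom_eq_two_mul_choose]
    have h3 : (2 * (k + 1)).choose (k + 1) = 2 * (2 * k + 1).choose k := by
      rw [show 2 * (k + 1) = 2 * k + 1 + 1 by ring, Nat.choose_succ_succ,
        Nat.choose_symm_half]
      ring
    have h4 : (4 : ℝ) ^ (k + 1) = 2 * 2 ^ (2 * k + 1) := by
      rw [show (4 : ℝ) = 2 ^ 2 by norm_num, ← pow_mul]; ring
    rw [h3, h4]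
    push_cast
    rw [mul_div_mul_left _ _ (by norm_num : (2 : ℝ) ≠ 0)]

theorem centralBinom_div_four_pow_succ (k : ℕ) :
    (Nat.centralBinom (k + 1) : ℝ) / 4 ^ (k + 1)
      = (Nat.centralBinom k : ℝ) / 4 ^ k * ((2 * k + 1) / (2 * k + 2)) := by
  have h := Nat.succ_mul_centralBinom_succ k
  have h' : ((k : ℝ) + 1) * Nat.centralBinom (k + 1) = 2 * (2 * k + 1) * Nat.centralBinom k := by
    exact_mod_cast h
  have h'' : (Nat.centralBinom (k + 1) : ℝ)
      = 2 * (2 * k + 1) * Nat.centralBinom k / (k + 1) := by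
    rw [← h']; field_simp
  rw [h'', pow_succ]
  field_simp
  ring

/-- By Wallis-type monotonicity `m ↦ middleProb m ^ 2 * ⌈m / 2⌉` increases. -/
theorem middleProb_sq_mul_le {m n : ℕ} (h : m ≤ n) :
    middleProb m ^ 2 * ((m + 1) / 2 : ℕ) ≤ middleProb n ^ 2 * ((n + 1) / 2 : ℕ) := by
  have hmono : Monotone fun k : ℕ => ((Nat.centralBinom k : ℝ) / 4 ^ k) ^ 2 * k := by
    refine monotone_nat_of_le_succ fun k => ?_
    rw [centralBinom_div_four_pow_succ, mul_pow, mul_assoc]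
    refine mul_le_mul_of_nonneg_left ?_ (by positivity)
    rw [div_pow, div_mul_eq_mul_div, le_div_iff₀ (by positivity)]
    push_cast
    nlinarith [(Nat.cast_nonneg k : (0 : ℝ) ≤ k)]
  rw [middleProb_eq_centralBinom, middleProb_eq_centralBinom n]
  exact hmono (by omega)

/-- The companion monotonicity: `m ↦ middleProb m ^ 2 * (2 * ⌈m / 2⌉ + 1)` decreases. -/
theorem middleProb_sq_le (n : ℕ) : middleProb n ^ 2 ≤ 1 / (n + 1) := by
  have hanti : Antitone fun k : ℕ => ((Nat.centralBinom k : ℝ) / 4 ^ k) ^ 2 * (2 * k + 1) := by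
    refine antitone_nat_of_succ_le fun k => ?_
    rw [centralBinom_div_four_pow_succ, mul_pow, mul_assoc]
    refine mul_le_mul_of_nonneg_left ?_ (by positivity)
    rw [div_pow, div_mul_eq_mul_div, div_le_iff₀ (by positivity)]
    push_cast
    nlinarith [(Nat.cast_nonneg k : (0 : ℝ) ≤ k)]
  have h := hanti (Nat.zero_le ((n + 1) / 2))
  simp only [Nat.centralBinom_zero, Nat.cast_one, pow_zero, Nat.cast_zero] at h
  rw [← middleProb_eq_centralBinom] at h
  have h2 : ((n : ℝ) + 1) ≤ 2 * ((n + 1) / 2 : ℕ) + 1 := by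
    exact_mod_cast (by omega : n + 1 ≤ 2 * ((n + 1) / 2) + 1)
  rw [le_div_iff₀ (by positivity)]
  nlinarith [sq_nonneg (middleProb n)]

theorem middleProb_sq_mul_le_mul_add_one {m n : ℕ} (h : m ≤ n) :
    middleProb m ^ 2 * m ≤ middleProb n ^ 2 * (n + 1) := by
  have h1 := middleProb_sq_mul_le h
  have h2 : (m : ℝ) ≤ 2 * ((m + 1) / 2 : ℕ) := by exact_mod_cast (by omega : m ≤ 2 * ((m + 1) / 2))
  have h3 : 2 * (((n + 1) / 2 : ℕ) : ℝ) ≤ n + 1 := by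
    exact_mod_cast (by omega : 2 * ((n + 1) / 2) ≤ n + 1)
  nlinarith [sq_nonneg (middleProb m), sq_nonneg (middleProb n)]

theorem eventually_middleProb_le {a : ℝ} (ha : 1 < a) :
    ∀ᶠ n : ℕ in atTop, ∀ m ≤ n, a⁻¹ * n ≤ m → middleProb m ≤ a * middleProb n := by
  have ha0 : 0 < a := by linarith
  filter_upwards [eventually_ge_atTop 1,
    tendsto_natCast_atTop_atTop.eventually_ge_atTop (1 / (a - 1))] with n hn hna m hm hmn
  have h1 := middleProb_sq_mul_le_mul_add_one hm
  have hn' : (0 : ℝ) < n := by exact_mod_cast hn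
  rw [div_le_iff₀ (by linarith)] at hna
  refine le_of_sq_le_sq ?_ (mul_pos ha0 (middleProb_pos n)).le
  rw [inv_mul_le_iff₀ ha0] at hmn
  have h2 : middleProb m ^ 2 * n ≤ middleProb m ^ 2 * (a * m) :=
    mul_le_mul_of_nonneg_left hmn (sq_nonneg _)
  have h3 : middleProb n ^ 2 * (n + 1) ≤ middleProb n ^ 2 * (a * n) :=
    mul_le_mul_of_nonneg_left (by linarith) (sq_nonneg _)
  rw [mul_pow, ← mul_le_mul_iff_left₀ hn']
  nlinarith

theorem middleProb_mul_middleProb_le {n g h : ℕ} {κ : ℝ} (hκ : 0 < κ) (hn : 1 ≤ n) (hg : g ≤ n)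
    (hh : h ≤ n) (hgκ : κ * n ≤ g) (hhκ : κ * n ≤ h) :
    middleProb g * middleProb h ≤ 2 / κ * middleProb n ^ 2 := by
  have hn' : (1 : ℝ) ≤ n := by exact_mod_cast hn
  have key : ∀ {m : ℕ}, m ≤ n → κ * n ≤ m → middleProb m ^ 2 ≤ 2 / κ * middleProb n ^ 2 := by
    intro m hm hmκ
    have h1 := middleProb_sq_mul_le_mul_add_one hm
    have h2 : middleProb m ^ 2 * (κ * n) ≤ middleProb m ^ 2 * m :=
      mul_le_mul_of_nonneg_left hmκ (sq_nonneg _)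
    have h3 : middleProb n ^ 2 * (n + 1) ≤ middleProb n ^ 2 * (2 * n) :=
      mul_le_mul_of_nonneg_left (by linarith) (sq_nonneg _)
    rw [div_mul_eq_mul_div, le_div_iff₀ hκ, ← mul_le_mul_iff_left₀ (by linarith : (0 : ℝ) < n)]
    nlinarith
  nlinarith [key hg hgκ, key hh hhκ, sq_nonneg (middleProb g - middleProb h)]

theorem tendsto_middleProb : Tendsto middleProb atTop (nhds 0) := by
  have h : Tendsto (fun n : ℕ => √(1 / ((n : ℝ) + 1))) atTop (nhds 0) := by
    simpa using (tendsto_one_div_add_atTop_nhds_zero_nat (𝕜 := ℝ)).sqrt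
  refine squeeze_zero (fun n => (middleProb_pos n).le) (fun n => ?_) h
  exact Real.le_sqrt_of_sq_le (middleProb_sq_le n)

/-- Binomial coefficients at bounded distance from the middle are asymptotically equal. -/
theorem tendsto_choose_sub_div_choose_middle (j : ℕ) :
    Tendsto (fun n : ℕ => (n.choose (n / 2 - j) : ℝ) / n.choose (n / 2)) atTop (nhds 1) := by
  induction j with
  | zero =>
    refine tendsto_const_nhds.congr fun n => ?_
    have : (n.choose (n / 2) : ℝ) ≠ 0 := by
      exact_mod_cast (Nat.choose_pos (Nat.div_le_self n 2)).ne'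
    simp [this]
  | succ j ih =>
    have hratio : Tendsto (fun n : ℕ => 1 - (2 * j + 2 : ℝ) / ((n - n / 2 + j + 1 : ℕ) : ℝ))
        atTop (nhds 1) := by
      have h1 : Tendsto (fun n : ℕ => n - n / 2 + j + 1) atTop atTop := by
        refine tendsto_atTop_mono (f := fun n => n / 2) (fun n => by omega) ?_
        exact Nat.tendsto_div_const_atTop (by norm_num)
      simpa using ((tendsto_natCast_atTop_atTop (R := ℝ)).comp h1).const_div_atTop
        (2 * j + 2 : ℝ) |>.const_sub 1
    refine tendsto_of_tendsto_of_tendsto_of_le_of_le' (by simpa only [mul_one] using ih.mul hratio)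
      tendsto_const_nhds ?_ ?_
    · filter_upwards [eventually_ge_atTop (2 * j + 2)] with n hn
      have hmid : (0 : ℝ) < n.choose (n / 2) := by
        exact_mod_cast Nat.choose_pos (Nat.div_le_self n 2)
      have hq : (0 : ℝ) < ((n - n / 2 + j + 1 : ℕ) : ℝ) := by positivity
      have h := Nat.choose_succ_right_eq n (n / 2 - (j + 1))
      rw [show n / 2 - (j + 1) + 1 = n / 2 - j by omega,
        show n - (n / 2 - (j + 1)) = n - n / 2 + j + 1 by omega] at h
      have h' : (n.choose (n / 2 - j) : ℝ) * ((n / 2 - j : ℕ) : ℝ)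
          = n.choose (n / 2 - (j + 1)) * ((n - n / 2 + j + 1 : ℕ) : ℝ) := by exact_mod_cast h
      have h2 : ((n - n / 2 + j + 1 : ℕ) : ℝ) - (2 * j + 2) ≤ ((n / 2 - j : ℕ) : ℝ) := by
        have : n - n / 2 + j + 1 ≤ (n / 2 - j) + (2 * j + 2) := by omega
        have : ((n - n / 2 + j + 1 : ℕ) : ℝ) ≤ ((n / 2 - j : ℕ) : ℝ) + (2 * j + 2) := by
          exact_mod_cast this
        linarith
      rw [div_mul_eq_mul_div]
      refine div_le_div_of_nonneg_right ?_ hmid.le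
      rw [← mul_le_mul_iff_left₀ hq, ← h', mul_assoc]
      refine mul_le_mul_of_nonneg_left ?_ (Nat.cast_nonneg _)
      rw [sub_mul, div_mul_cancel₀ _ hq.ne']
      linarith
    · refine Eventually.of_forall fun n => ?_
      refine div_le_one_of_le₀ ?_ (Nat.cast_nonneg _)
      exact_mod_cast Nat.choose_le_middle _ _

theorem eventually_le_largestBinomSum {s : ℕ} (hs1 : 1 ≤ s) {θ : ℝ} (hθ : θ < 1) :
    ∀ᶠ n : ℕ in atTop, θ * s * middleProb n ≤ (2 ^ n : ℝ)⁻¹ * (largestBinomSum n s : ℝ) := by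
  filter_upwards [(tendsto_choose_sub_div_choose_middle s).eventually_const_le hθ,
    eventually_ge_atTop (2 * s + 2)] with n hn hns
  have hmid : (0 : ℝ) < n.choose (n / 2) := by
    exact_mod_cast Nat.choose_pos (Nat.div_le_self n 2)
  rw [le_div_iff₀ hmid] at hn
  rw [largestBinomSum_eq_sum_centralWindow hs1 (by omega)]
  have hle : (s : ℝ) * n.choose (n / 2 - s) ≤ ∑ k ∈ centralWindow n s, (n.choose k : ℝ) := by
    rw [← nsmul_eq_mul]
    nth_rewrite 1 [← card_centralWindow n s]
    refine Finset.card_nsmul_le_sum _ _ _ fun k hk => ?_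
    have hk' := Finset.mem_Ico.1 hk
    exact Nat.cast_le.2 (choose_le_choose_of_min_le (by omega) (by omega) (by omega))
  rw [middleProb]
  push_cast
  rw [inv_mul_eq_div, mul_div_assoc']
  refine div_le_div_of_nonneg_right ?_ (by positivity)
  have hs0 : (0 : ℝ) ≤ s := Nat.cast_nonneg _
  nlinarith

/-! ### The component orthogonal to a line -/

section Geometry

variable {E : Type*} [NormedAddCommGroup E] [InnerProductSpace ℝ E]

/-- For a unit vector `e`, the component of a vector orthogonal to `e`. -/
noncomputable def perp (e : E) : E →ₗ[ℝ] E :=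
  LinearMap.id - (innerₗ E e).smulRight e

theorem perp_apply (e v : E) : perp e v = v - inner ℝ e v • e := by
  simp [perp]

theorem inner_eq_mul_add_inner_perp {e : E} (he : ‖e‖ = 1) (v w : E) :
    inner ℝ v w = inner ℝ e v * inner ℝ e w + inner ℝ (perp e v) (perp e w) := by
  have h : inner ℝ e e = (1 : ℝ) := by rw [real_inner_self_eq_norm_sq, he]; norm_num
  simp only [perp_apply, inner_sub_left, inner_sub_right, real_inner_smul_left,
    real_inner_smul_right, h, real_inner_comm e v]
  ring

theorem norm_sq_eq_sq_add_norm_perp_sq {e : E} (he : ‖e‖ = 1) (v : E) :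
    ‖v‖ ^ 2 = inner ℝ e v ^ 2 + ‖perp e v‖ ^ 2 := by
  rw [← real_inner_self_eq_norm_sq, inner_eq_mul_add_inner_perp he, real_inner_self_eq_norm_sq]
  ring

theorem norm_perp_le {e : E} (he : ‖e‖ = 1) (v : E) : ‖perp e v‖ ≤ ‖v‖ := by
  have := norm_sq_eq_sq_add_norm_perp_sq he v
  exact le_of_sq_le_sq (by nlinarith [sq_nonneg (inner ℝ e v : ℝ)]) (norm_nonneg _)

theorem abs_inner_le_norm_of_norm_eq_one {e : E} (he : ‖e‖ = 1) (v : E) :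
    |inner ℝ e v| ≤ ‖v‖ := by
  simpa [he] using abs_real_inner_le_norm e v

theorem norm_le_mul_inner {e : E} (he : ‖e‖ = 1) {β : ℝ} {v : E}
    (h0 : 0 ≤ (inner ℝ e v : ℝ)) (h : ‖perp e v‖ ≤ β * inner ℝ e v) :
    ‖v‖ ≤ (1 + β) * inner ℝ e v := by
  have h1 : v = inner ℝ e v • e + perp e v := by rw [perp_apply]; abel
  have h2 : ‖v‖ ≤ ‖(inner ℝ e v : ℝ) • e‖ + ‖perp e v‖ := by
    conv_lhs => rw [h1]
    exact norm_add_le _ _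
  rw [norm_smul, he, mul_one, Real.norm_of_nonneg h0] at h2
  linarith

/-- The squared sine of the angle between `v` and the line spanned by the unit vector `e`. -/
noncomputable def sinSq (e v : E) : ℝ := ‖perp e v‖ ^ 2 / ‖v‖ ^ 2

theorem sinSq_nonneg (e v : E) : 0 ≤ sinSq e v := by unfold sinSq; positivity

/-- If `v` and `w` make angles `a` and `b` with `e` and `sin² a + sin² b ≤ 1`, then
`cos (a + b) ≥ 1 - sin² a - sin² b`. -/
theorem one_sub_sinSq_sub_sinSq_le_inner {e : E} (he : ‖e‖ = 1) {v w : E}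
    (hv : 1 ≤ ‖v‖) (hw : 1 ≤ ‖w‖) (hev : 0 ≤ (inner ℝ e v : ℝ)) (hew : 0 ≤ (inner ℝ e w : ℝ))
    (h : sinSq e v + sinSq e w ≤ 1) :
    1 - sinSq e v - sinSq e w ≤ inner ℝ v w := by
  have hv0 : 0 < ‖v‖ := by linarith
  have hw0 : 0 < ‖w‖ := by linarith
  have h1 := norm_sq_eq_sq_add_norm_perp_sq he v
  have h2 := norm_sq_eq_sq_add_norm_perp_sq he w
  set S := ‖perp e v‖ / ‖v‖ with hS
  set T := ‖perp e w‖ / ‖w‖ with hT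
  set a := (inner ℝ e v : ℝ) / ‖v‖ with ha
  set b := (inner ℝ e w : ℝ) / ‖w‖ with hb
  have hxS : sinSq e v = S ^ 2 := by rw [sinSq, hS, div_pow]
  have hxT : sinSq e w = T ^ 2 := by rw [sinSq, hT, div_pow]
  have ha2 : a ^ 2 = 1 - S ^ 2 := by rw [ha, hS, div_pow, div_pow]; field_simp; linarith
  have hb2 : b ^ 2 = 1 - T ^ 2 := by rw [hb, hT, div_pow, div_pow]; field_simp; linarith
  have ha0 : 0 ≤ a := by positivity
  have hb0 : 0 ≤ b := by positivity
  have hS0 : 0 ≤ S := by positivity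
  have hT0 : 0 ≤ T := by positivity
  rw [hxS, hxT] at h ⊢
  have hm : 0 ≤ 1 - S ^ 2 - T ^ 2 := by linarith
  have hab : 1 - S ^ 2 - T ^ 2 + S * T ≤ a * b := by
    refine le_of_sq_le_sq ?_ (by positivity)
    rw [mul_pow, ha2, hb2]
    nlinarith [mul_nonneg hm (sq_nonneg (S - T))]
  have hcs := neg_le_of_abs_le (abs_real_inner_le_norm (perp e v) (perp e w))
  have hin : ‖v‖ * ‖w‖ * (a * b - S * T) ≤ inner ℝ v w := by
    rw [inner_eq_mul_add_inner_perp he v w]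
    have e1 : ‖v‖ * ‖w‖ * (a * b - S * T)
        = inner ℝ e v * inner ℝ e w - ‖perp e v‖ * ‖perp e w‖ := by
      rw [ha, hb, hS, hT]; field_simp
    linarith
  have hvw : 1 ≤ ‖v‖ * ‖w‖ := one_le_mul_of_one_le_of_one_le hv hw
  nlinarith

variable {ι : Type*} [DecidableEq ι]

/-- The sum of `s` vectors of length at least one has squared length at least
`s + ∑ i ≠ j, (1 - x i - x j) = s ^ 2 - 2 * (s - 1) * ∑ i, x i`, where `x = sinSq e ∘ v`. -/
theorem sq_add_one_le_norm_sum_sq {e : E} (he : ‖e‖ = 1) (v : ι → E) (T : Finset ι)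
    (hT0 : 1 ≤ T.card) (hv : ∀ i ∈ T, 1 ≤ ‖v i‖) (hev : ∀ i ∈ T, 0 ≤ (inner ℝ e (v i) : ℝ))
    (hx : ∑ i ∈ T, sinSq e (v i) ≤ 1) :
    ((T.card : ℝ) - 1) ^ 2 + 1 ≤ ‖∑ i ∈ T, v i‖ ^ 2 := by
  rw [← real_inner_self_eq_norm_sq, sum_inner]
  simp_rw [inner_sum]
  have hle : ∑ i ∈ T, ∑ j ∈ T, ((1 - sinSq e (v i) - sinSq e (v j))
      + if i = j then 2 * sinSq e (v i) else 0) ≤ ∑ i ∈ T, ∑ j ∈ T, inner ℝ (v i) (v j) := by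
    refine Finset.sum_le_sum fun i hi => Finset.sum_le_sum fun j hj => ?_
    split_ifs with hij
    · subst hij
      rw [real_inner_self_eq_norm_sq]
      nlinarith [hv i hi]
    · rw [add_zero]
      refine one_sub_sinSq_sub_sinSq_le_inner he (hv i hi) (hv j hj) (hev i hi) (hev j hj) ?_
      rw [← Finset.sum_pair (f := fun k => sinSq e (v k)) hij]
      refine le_trans (Finset.sum_le_sum_of_subset_of_nonneg ?_
        fun k _ _ => sinSq_nonneg _ _) hx
      intro k hk
      rcases Finset.mem_insert.1 hk with rfl | hk
      · exact hi
      · exact Finset.mem_singleton.1 hk ▸ hj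
  refine le_trans ?_ hle
  have hsum : ∑ i ∈ T, ∑ j ∈ T, ((1 - sinSq e (v i) - sinSq e (v j))
      + if i = j then 2 * sinSq e (v i) else 0)
      = (T.card : ℝ) ^ 2 - 2 * ((T.card : ℝ) - 1) * ∑ i ∈ T, sinSq e (v i) := by
    simp only [Finset.sum_add_distrib, Finset.sum_sub_distrib, Finset.sum_const, nsmul_eq_mul,
      mul_one, Finset.sum_ite_eq]
    rw [Finset.sum_congr rfl (fun i hi => if_pos hi), ← Finset.mul_sum, ← Finset.mul_sum]
    ring
  rw [hsum]
  have : (1 : ℝ) ≤ T.card := by exact_mod_cast hT0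
  nlinarith

/-- A sum over more vectors is not shorter, since all the pairwise inner products are
nonnegative. -/
theorem sq_add_one_le_norm_sum_sq_of_le_card {e : E} (he : ‖e‖ = 1) (v : ι → E) (T : Finset ι)
    {s : ℕ} (hs1 : 1 ≤ s) (hsT : s ≤ T.card) (hv : ∀ i ∈ T, 1 ≤ ‖v i‖)
    (hev : ∀ i ∈ T, 0 ≤ (inner ℝ e (v i) : ℝ))
    (hx : ∀ U ⊆ T, U.card ≤ s + 1 → ∑ i ∈ U, sinSq e (v i) ≤ 1) :
    ((s : ℝ) - 1) ^ 2 + 1 ≤ ‖∑ i ∈ T, v i‖ ^ 2 := by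
  obtain ⟨U, hU, hUs⟩ := Finset.exists_subset_card_eq hsT
  have h1 := sq_add_one_le_norm_sum_sq he v U (by omega) (fun i hi => hv i (hU hi))
    (fun i hi => hev i (hU hi)) (hx U hU (by omega))
  rw [hUs] at h1
  have h2 : 0 ≤ inner ℝ (∑ i ∈ U, v i) (∑ i ∈ T \ U, v i) := by
    rw [sum_inner]
    simp_rw [inner_sum]
    refine Finset.sum_nonneg fun i hi => Finset.sum_nonneg fun j hj => ?_
    obtain ⟨hjT, hjU⟩ := Finset.mem_sdiff.1 hj
    have hij : i ≠ j := fun h => hjU (h ▸ hi)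
    have h3 := hx {i, j} (by
      intro k hk
      rcases Finset.mem_insert.1 hk with rfl | hk
      · exact hU hi
      · exact Finset.mem_singleton.1 hk ▸ hjT) (by rw [Finset.card_pair hij]; omega)
    rw [Finset.sum_pair hij] at h3
    have := one_sub_sinSq_sub_sinSq_le_inner he (hv i (hU hi)) (hv j hjT) (hev i (hU hi))
      (hev j hjT) h3
    linarith
  rw [← Finset.sum_sdiff hU, norm_add_sq_real, real_inner_comm]
  nlinarith [sq_nonneg ‖∑ i ∈ T \ U, v i‖]

/-- Some signed sum of vectors has squared length at least the sum of the squared lengths, as the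
average over all signs does. -/
theorem exists_sum_norm_sq_le_norm_sq (p : ι → E) (T : Finset ι) :
    ∃ D ⊆ T, ∑ i ∈ T, ‖p i‖ ^ 2 ≤ ‖∑ i ∈ D, p i - ∑ i ∈ T \ D, p i‖ ^ 2 := by
  induction T using Finset.induction_on with
  | empty => exact ⟨∅, by simp⟩
  | insert a T ha ih =>
    obtain ⟨D, hD, h⟩ := ih
    have haD : a ∉ D := fun h => ha (hD h)
    set z := ∑ i ∈ D, p i - ∑ i ∈ T \ D, p i with hz
    rcases le_total 0 (inner ℝ z (p a) : ℝ) with h0 | h0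
    · refine ⟨insert a D, Finset.insert_subset_insert _ hD, ?_⟩
      have : insert a T \ insert a D = T \ D := by
        ext i; simp only [Finset.mem_sdiff, Finset.mem_insert]; grind
      rw [this, Finset.sum_insert ha, Finset.sum_insert haD, add_sub_assoc, ← hz, add_comm (p a),
        norm_add_sq_real]
      linarith
    · refine ⟨D, hD.trans (Finset.subset_insert _ _), ?_⟩
      rw [Finset.insert_sdiff_of_notMem _ haD, Finset.sum_insert ha,
        Finset.sum_insert (by simp [ha]), add_comm (p a), ← sub_sub, ← hz, norm_sub_sq_real]
      linarith

end Geometry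

/-! ### Counting subset sums in a ball -/

section Hits

variable {E : Type*} [NormedAddCommGroup E] {ι : Type*}

/-- The subsets of `G` whose subset sum lies in the closed ball of centre `c` and radius `r`. -/
noncomputable def hits (v : ι → E) (G : Finset ι) (c : E) (r : ℝ) : Finset (Finset ι) :=
  open Classical in G.powerset.filter fun A => ‖∑ i ∈ A, v i - c‖ ≤ r

theorem mem_hits {v : ι → E} {G : Finset ι} {c : E} {r : ℝ} {A : Finset ι} :
    A ∈ hits v G c r ↔ A ⊆ G ∧ ‖∑ i ∈ A, v i - c‖ ≤ r := by
  simp [hits]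

/-- The probability that a uniformly random subset of `G` has its subset sum in the closed
ball of centre `c` and radius `r`. -/
noncomputable def hitProb (v : ι → E) (G : Finset ι) (c : E) (r : ℝ) : ℝ :=
  ((hits v G c r).card : ℝ) / 2 ^ G.card

variable [DecidableEq ι]

theorem card_hits_union (v : ι → E) {G H : Finset ι} (hGH : Disjoint G H) (c : E) (r : ℝ) :
    (hits v (G ∪ H) c r).card
      = ∑ D ∈ H.powerset, (hits v G (c - ∑ i ∈ D, v i) r).card := by
  rw [← Finset.card_sigma]
  refine Finset.card_bij' (fun A _ => ⟨A ∩ H, A ∩ G⟩) (fun x _ => x.2 ∪ x.1) ?_ ?_ ?_ ?_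
  · intro A hA
    obtain ⟨hA1, hA2⟩ := mem_hits.1 hA
    refine Finset.mem_sigma.2 ⟨Finset.mem_powerset.2 Finset.inter_subset_right,
      mem_hits.2 ⟨Finset.inter_subset_right, ?_⟩⟩
    have : ∑ i ∈ A, v i = ∑ i ∈ A ∩ G, v i + ∑ i ∈ A ∩ H, v i := by
      rw [← Finset.sum_union (hGH.mono Finset.inter_subset_right Finset.inter_subset_right),
        ← Finset.inter_union_distrib_left, Finset.inter_eq_left.2 hA1]
    rw [this] at hA2
    convert hA2 using 2
    abel
  · rintro ⟨D, A⟩ hx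
    obtain ⟨hD, hA⟩ := Finset.mem_sigma.1 hx
    have hD := Finset.mem_powerset.1 hD
    obtain ⟨hA1, hA2⟩ := mem_hits.1 hA
    refine mem_hits.2 ⟨Finset.union_subset_union hA1 hD, ?_⟩
    rw [Finset.sum_union (hGH.mono hA1 hD)]
    convert hA2 using 2
    abel
  · intro A hA
    obtain ⟨hA1, -⟩ := mem_hits.1 hA
    simp only
    rw [← Finset.inter_union_distrib_left, Finset.inter_eq_left.2 hA1]
  · rintro ⟨D, A⟩ hx
    obtain ⟨hD, hA⟩ := Finset.mem_sigma.1 hx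
    have hD := Finset.mem_powerset.1 hD
    obtain ⟨hA1, -⟩ := mem_hits.1 hA
    have h1 : (A ∪ D) ∩ H = D := by
      rw [Finset.union_inter_distrib_right, Finset.disjoint_iff_inter_eq_empty.1
        (hGH.mono_left hA1), Finset.empty_union, Finset.inter_eq_left.2 hD]
    have h2 : (A ∪ D) ∩ G = A := by
      rw [Finset.union_inter_distrib_right, Finset.disjoint_iff_inter_eq_empty.1
        (hGH.symm.mono_left hD), Finset.union_empty, Finset.inter_eq_left.2 hA1]
    simp only
    rw [h1, h2]

/-- Conditioning on the signs outside `G`. -/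
theorem hitProb_le_of_subset (v : ι → E) {G I : Finset ι} (hGI : G ⊆ I) {r b : ℝ}
    (h : ∀ c, hitProb v G c r ≤ b) (c : E) : hitProb v I c r ≤ b := by
  have hI : I = G ∪ I \ G := (Finset.union_sdiff_of_subset hGI).symm
  have hcard : I.card = G.card + (I \ G).card := by
    rw [Finset.card_sdiff_of_subset hGI, Nat.add_sub_cancel' (Finset.card_le_card hGI)]
  have h2 : (0 : ℝ) < 2 ^ G.card := by positivity
  rw [hitProb, div_le_iff₀ (by positivity), hcard]
  conv_lhs => rw [hI]
  rw [card_hits_union v Finset.disjoint_sdiff]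
  push_cast
  calc ∑ D ∈ (I \ G).powerset, ((hits v G (c - ∑ i ∈ D, v i) r).card : ℝ)
      ≤ ∑ D ∈ (I \ G).powerset, b * 2 ^ G.card :=
        Finset.sum_le_sum fun D _ => (div_le_iff₀ h2).1 (h _)
    _ = b * 2 ^ (G.card + (I \ G).card) := by
        rw [Finset.sum_const, Finset.card_powerset, nsmul_eq_mul, pow_add]
        push_cast
        ring

/-- Reversing the vectors indexed by `J` amounts to taking the symmetric difference with `J` and
translating the ball. -/
theorem exists_card_hits_le_card_hits_neg (v : ι → E) {I J : Finset ι} (hJ : J ⊆ I) (c : E)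
    (r : ℝ) : ∃ c', (hits v I c r).card
      ≤ (hits (fun i => if i ∈ J then -v i else v i) I c' r).card := by
  refine ⟨c - ∑ i ∈ J, v i, Finset.card_le_card_of_injOn (fun A => symmDiff A J) ?_ ?_⟩
  · intro A hA
    obtain ⟨hA1, hA2⟩ := mem_hits.1 hA
    refine mem_hits.2 ⟨?_, ?_⟩
    · exact Finset.union_subset (Finset.sdiff_subset.trans hA1) (Finset.sdiff_subset.trans hJ)
    · have h1 : ∑ i ∈ symmDiff A J, (if i ∈ J then -v i else v i)
          = ∑ i ∈ A \ J, v i + ∑ i ∈ J \ A, -v i := by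
        rw [symmDiff_def, Finset.sup_eq_union, Finset.sum_union disjoint_sdiff_sdiff]
        congr 1
        · exact Finset.sum_congr rfl fun i hi => if_neg (Finset.mem_sdiff.1 hi).2
        · exact Finset.sum_congr rfl fun i hi => if_pos (Finset.mem_sdiff.1 hi).1
      have h2 : ∑ i ∈ A, v i = ∑ i ∈ A ∩ J, v i + ∑ i ∈ A \ J, v i :=
        (Finset.sum_inter_add_sum_sdiff A J v).symm
      have h3 : ∑ i ∈ J, v i = ∑ i ∈ A ∩ J, v i + ∑ i ∈ J \ A, v i := by
        rw [Finset.inter_comm]; exact (Finset.sum_inter_add_sum_sdiff J A v).symm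
      rw [h1, Finset.sum_neg_distrib, h3]
      rw [h2] at hA2
      convert hA2 using 2
      abel
  · exact (symmDiff_left_injective J).injOn

end Hits

section Chains

variable {E : Type*} [NormedAddCommGroup E] [InnerProductSpace ℝ E] {ι : Type*} [DecidableEq ι]

/-- The bound for vectors in a half-space whose angles with its normal are small on average:
a chain of more than `s` hits would contain two hits at distance more than `2r`. -/
theorem card_hits_le_largestBinomSum {e : E} (he : ‖e‖ = 1) (v : ι → E) (I : Finset ι)
    {s : ℕ} (hs1 : 1 ≤ s) (hsI : s ≤ I.card) {r : ℝ} (hr : (2 * r) ^ 2 < ((s : ℝ) - 1) ^ 2 + 1)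
    (hr0 : 0 ≤ r)
    (hv : ∀ i ∈ I, 1 ≤ ‖v i‖) (hev : ∀ i ∈ I, 0 ≤ (inner ℝ e (v i) : ℝ))
    (hx : ∀ U ⊆ I, U.card ≤ s + 1 → ∑ i ∈ U, sinSq e (v i) ≤ 1) (c : E) :
    (hits v I c r).card ≤ largestBinomSum I.card s := by
  refine card_le_largestBinomSum_of_isChain I hs1 hsI _
    (fun A hA => Finset.mem_powerset.2 (mem_hits.1 hA).1) fun C hC hCc => ?_
  by_contra! hlt
  obtain ⟨A, hA, A', hA', hAA', hcard⟩ :=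
    exists_subset_card_le_card_sdiff_add_one hCc (Finset.card_pos.1 (by omega))
  obtain ⟨-, h1⟩ := mem_hits.1 (hC hA)
  obtain ⟨h3, h2⟩ := mem_hits.1 (hC hA')
  have hsub : A' \ A ⊆ I := Finset.sdiff_subset.trans h3
  have hbig := sq_add_one_le_norm_sum_sq_of_le_card he v (A' \ A) hs1 (by omega)
    (fun i hi => hv i (hsub hi)) (fun i hi => hev i (hsub hi))
    (fun U hU => hx U (hU.trans hsub))
  have hdist : ‖∑ i ∈ A' \ A, v i‖ ≤ 2 * r := by
    have : ∑ i ∈ A' \ A, v i = (∑ i ∈ A', v i - c) - (∑ i ∈ A, v i - c) := by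
      rw [← Finset.sum_sdiff hAA']; abel
    rw [this]
    exact (norm_sub_le _ _).trans (by linarith)
  nlinarith [norm_nonneg (∑ i ∈ A' \ A, v i)]

end Chains

/-! ### Gaining from vectors off the main direction -/

section Gain

variable {E : Type*} [NormedAddCommGroup E] [InnerProductSpace ℝ E] {ι : Type*}

theorem norm_perp_sum_le {e : E} {β : ℝ} (v : ι → E) (A : Finset ι)
    (hA : ∀ i ∈ A, ‖perp e (v i)‖ ≤ β * inner ℝ e (v i)) :
    ‖perp e (∑ i ∈ A, v i)‖ ≤ β * inner ℝ e (∑ i ∈ A, v i) := by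
  rw [map_sum, inner_sum, Finset.mul_sum]
  exact (norm_sum_le _ _).trans (Finset.sum_le_sum hA)

theorem card_le_mul_inner_sum {e : E} (he : ‖e‖ = 1) {β : ℝ} (hβ : 0 ≤ β) (v : ι → E)
    (A : Finset ι) (hv : ∀ i ∈ A, 1 ≤ ‖v i‖) (hev : ∀ i ∈ A, 0 ≤ (inner ℝ e (v i) : ℝ))
    (hA : ∀ i ∈ A, ‖perp e (v i)‖ ≤ β * inner ℝ e (v i)) :
    (A.card : ℝ) ≤ (1 + β) * ‖∑ i ∈ A, v i‖ := by
  calc (A.card : ℝ) = ∑ i ∈ A, (1 : ℝ) := by simp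
    _ ≤ ∑ i ∈ A, (1 + β) * inner ℝ e (v i) := Finset.sum_le_sum fun i hi =>
        (hv i hi).trans (norm_le_mul_inner he (hev i hi) (hA i hi))
    _ = (1 + β) * inner ℝ e (∑ i ∈ A, v i) := by rw [inner_sum, Finset.mul_sum]
    _ ≤ (1 + β) * ‖∑ i ∈ A, v i‖ := mul_le_mul_of_nonneg_left
        ((le_abs_self _).trans (abs_inner_le_norm_of_norm_eq_one he _)) (by linarith)

variable [DecidableEq ι]

/-- Along a chain, subset sums of vectors of a narrow cone about `e` move within the double cone. -/
theorem norm_perp_sum_sub_sum_le {e : E} (he : ‖e‖ = 1) {β : ℝ} (hβ : 0 ≤ β) (v : ι → E)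
    {G : Finset ι} (hG : ∀ i ∈ G, ‖perp e (v i)‖ ≤ β * inner ℝ e (v i)) {A A' : Finset ι}
    (hA : A ⊆ G) (hA' : A' ⊆ G) (h : A ⊆ A' ∨ A' ⊆ A) :
    ‖perp e (∑ i ∈ A, v i - ∑ i ∈ A', v i)‖ ≤ β * ‖∑ i ∈ A, v i - ∑ i ∈ A', v i‖ := by
  have key : ∀ {B B' : Finset ι}, B' ⊆ G → B ⊆ B' →
      ‖perp e (∑ i ∈ B', v i - ∑ i ∈ B, v i)‖ ≤ β * ‖∑ i ∈ B', v i - ∑ i ∈ B, v i‖ := by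
    intro B B' hB' hBB'
    rw [← Finset.sum_sdiff hBB', add_sub_cancel_right]
    refine (norm_perp_sum_le v _ fun i hi => hG i (hB' (Finset.sdiff_subset hi))).trans ?_
    exact mul_le_mul_of_nonneg_left
      ((le_abs_self _).trans (abs_inner_le_norm_of_norm_eq_one he _)) hβ
  rcases h with h | h
  · have := key hA' h
    rwa [← neg_sub, map_neg, norm_neg, norm_neg] at this
  · exact key hA h

theorem card_sdiff_le_mul_norm_sub {e : E} (he : ‖e‖ = 1) {β : ℝ} (hβ : 0 ≤ β) {v : ι → E}
    {G : Finset ι} (hv : ∀ i ∈ G, 1 ≤ ‖v i‖) (hev : ∀ i ∈ G, 0 ≤ (inner ℝ e (v i) : ℝ))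
    (hG : ∀ i ∈ G, ‖perp e (v i)‖ ≤ β * inner ℝ e (v i)) {A A' : Finset ι}
    (hA' : A' ⊆ G) (h : A ⊆ A') (c : E) :
    ((A' \ A).card : ℝ) ≤ (1 + β) * ‖(∑ i ∈ A', v i - c) - (∑ i ∈ A, v i - c)‖ := by
  have hsub : A' \ A ⊆ G := Finset.sdiff_subset.trans hA'
  have h1 := card_le_mul_inner_sum he hβ v (A' \ A) (fun i hi => hv i (hsub hi))
    (fun i hi => hev i (hsub hi)) (fun i hi => hG i (hsub hi))
  have h2 : ∑ i ∈ A' \ A, v i = (∑ i ∈ A', v i - c) - (∑ i ∈ A, v i - c) := by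
    rw [← Finset.sum_sdiff h]; abel
  rwa [h2] at h1

/-- Two hits on a chain of nearly parallel vectors which lie `s - 1` steps apart have their
midpoint close to the centre of the ball. -/
theorem norm_add_sub_le_of_hits {x y : E} {s r β : ℝ} (hβ : 0 ≤ β) (hs : 0 ≤ s - 1)
    (hx : ‖x‖ ≤ r) (hy : ‖y‖ ≤ r) (h : s - 1 ≤ (1 + β) * ‖y - x‖) :
    ‖x + y‖ ≤ √((2 * r) ^ 2 - ((s - 1) / (1 + β)) ^ 2) := by
  refine Real.le_sqrt_of_sq_le ?_
  have h1 := parallelogram_law_with_norm ℝ y x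
  have h2 : (s - 1) / (1 + β) ≤ ‖y - x‖ := by
    rw [div_le_iff₀ (by positivity)]; linarith
  have h3 : 0 ≤ (s - 1) / (1 + β) := by positivity
  have h4 : ((s - 1) / (1 + β)) ^ 2 ≤ ‖y - x‖ ^ 2 := pow_le_pow_left₀ h3 h2 2
  have h5 : ‖x‖ ^ 2 ≤ r ^ 2 := pow_le_pow_left₀ (norm_nonneg _) hx 2
  have h6 : ‖y‖ ^ 2 ≤ r ^ 2 := pow_le_pow_left₀ (norm_nonneg _) hy 2
  rw [add_comm x y]
  nlinarith

/-- Let the vectors of `G` be nearly parallel to `e` and let those of `T` be transversal to it,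
with orthogonal components of total squared length more than `q`. Then for a given chain of
subsets of `G`, some translate of the ball by a subset sum of `T` gets fewer than `s` hits.

If all translates got `s` hits, flipping the elements of `T` one by one would show that the
vectors of `T` are bounded; two translates shifted from each other by a signed sum `w` of `T`
with `‖perp e w‖ ^ 2 > q` would then both be centred too close to the chain. -/
theorem exists_card_filter_hits_lt {e : E} (he : ‖e‖ = 1) {r β ζ q : ℝ} {s K : ℕ} (hs1 : 1 ≤ s)
    (hβ0 : 0 ≤ β) (hβ1 : β ≤ 1) (hζ : 0 < ζ) (hβζ : 2 * β ≤ ζ) (hr : 0 ≤ r) (hq0 : 0 ≤ q)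
    (hq : √((2 * r) ^ 2 - (((s : ℝ) - 1) / (1 + β)) ^ 2)
      + β * (2 * r + K * (8 * r / ζ)) ≤ √q)
    {v : ι → E} {G T : Finset ι} (hv : ∀ i ∈ G, 1 ≤ ‖v i‖)
    (hev : ∀ i ∈ G, 0 ≤ (inner ℝ e (v i) : ℝ))
    (hG : ∀ i ∈ G, ‖perp e (v i)‖ ≤ β * inner ℝ e (v i))
    (hT : ∀ i ∈ T, ζ * ‖v i‖ ≤ ‖perp e (v i)‖) (hTK : T.card ≤ K)
    (hTq : q < ∑ i ∈ T, ‖perp e (v i)‖ ^ 2) {C : Finset (Finset ι)}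
    (hC : IsChain (· ⊆ ·) (C : Set (Finset ι))) (c : E) :
    ∃ D ⊆ T, (C ∩ hits v G (c - ∑ i ∈ D, v i) r).card < s := by
  by_contra! hall
  have hex : ∀ D ⊆ T, ∃ A A' : Finset ι, A ∈ C ∧ A' ∈ C ∧
      A ∈ hits v G (c - ∑ i ∈ D, v i) r ∧ A' ∈ hits v G (c - ∑ i ∈ D, v i) r ∧
      A ⊆ A' ∧ s ≤ (A' \ A).card + 1 := by
    intro D hD
    have hs := hall D hD
    obtain ⟨A, hA, A', hA', hAA', hcard⟩ := exists_subset_card_le_card_sdiff_add_one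
      (hC.mono (Finset.coe_subset.2 (Finset.inter_subset_left
        (s₂ := hits v G (c - ∑ i ∈ D, v i) r)))) (Finset.card_pos.1 (by omega))
    obtain ⟨hA1, hA2⟩ := Finset.mem_inter.1 hA
    obtain ⟨hA1', hA2'⟩ := Finset.mem_inter.1 hA'
    exact ⟨A, A', hA1, hA1', hA2, hA2', hAA', hs.trans hcard⟩
  choose! A A' hAC hAC' hA hA' hAA' hcard using hex
  have hperp : ∀ {B B' : Finset ι} {D D' : Finset ι}, B ∈ C → B' ∈ C →
      B ∈ hits v G (c - ∑ i ∈ D, v i) r → B' ∈ hits v G (c - ∑ i ∈ D', v i) r →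
      ‖perp e (∑ i ∈ B, v i - ∑ i ∈ B', v i)‖
        ≤ β * (2 * r + ‖∑ i ∈ D, v i - ∑ i ∈ D', v i‖) := by
    intro B B' D D' hBC hBC' hB hB'
    obtain ⟨hBG, hBc⟩ := mem_hits.1 hB
    obtain ⟨hBG', hBc'⟩ := mem_hits.1 hB'
    refine (norm_perp_sum_sub_sum_le he hβ0 v hG hBG hBG' (hC.total hBC hBC')).trans ?_
    refine mul_le_mul_of_nonneg_left ?_ hβ0
    have hz : ∑ i ∈ B, v i - ∑ i ∈ B', v i = (∑ i ∈ B, v i - (c - ∑ i ∈ D, v i))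
        - (∑ i ∈ B', v i - (c - ∑ i ∈ D', v i)) - (∑ i ∈ D, v i - ∑ i ∈ D', v i) := by abel
    rw [hz]
    refine (norm_sub_le _ _).trans ?_
    have := norm_sub_le (∑ i ∈ B, v i - (c - ∑ i ∈ D, v i))
      (∑ i ∈ B', v i - (c - ∑ i ∈ D', v i))
    linarith
  -- Compare the translates that belong to `∅` and `{i}`.
  have hbound : ∀ i ∈ T, ‖v i‖ ≤ 8 * r / ζ := by
    intro i hi
    have h0 := Finset.empty_subset T
    have h1 := Finset.singleton_subset_iff.2 hi
    have hz := hperp (hAC _ h1) (hAC _ h0) (hA _ h1) (hA _ h0)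
    have hc1 := (mem_hits.1 (hA _ h1)).2
    have hc0 := (mem_hits.1 (hA _ h0)).2
    simp only [Finset.sum_singleton, Finset.sum_empty, sub_zero] at hz hc1 hc0
    have hdecomp : v i = ((∑ j ∈ A {i}, v j - (c - v i)) - (∑ j ∈ A ∅, v j - c))
        - (∑ j ∈ A {i}, v j - ∑ j ∈ A ∅, v j) := by abel
    have h2 : ‖perp e (v i)‖ ≤ 2 * r + β * (2 * r + ‖v i‖) := by
      conv_lhs => rw [hdecomp, map_sub]
      refine (norm_sub_le _ _).trans (add_le_add ?_ hz)
      exact (norm_perp_le he _).trans ((norm_sub_le _ _).trans (by linarith))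
    have h3 := hT i hi
    have h4 := norm_nonneg (v i)
    rw [le_div_iff₀ hζ]
    nlinarith
  -- The translates by `D` and by its complement are displaced from each other by `w`, which is
  -- far from the main direction.
  obtain ⟨D, hD, hDsum⟩ := exists_sum_norm_sq_le_norm_sq (fun i => perp e (v i)) T
  have hD' : T \ D ⊆ T := Finset.sdiff_subset
  set w := ∑ i ∈ D, v i - ∑ i ∈ T \ D, v i with hw
  have hperpw : perp e w = ∑ i ∈ D, perp e (v i) - ∑ i ∈ T \ D, perp e (v i) := by
    rw [hw, map_sub, map_sum, map_sum]
  have hwnorm : ‖w‖ ≤ K * (8 * r / ζ) := by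
    have h1 : ‖w‖ ≤ ∑ i ∈ T, ‖v i‖ := by
      rw [← Finset.sum_sdiff hD, add_comm]
      exact (norm_sub_le _ _).trans (add_le_add (norm_sum_le _ _) (norm_sum_le _ _))
    refine h1.trans ((Finset.sum_le_card_nsmul T _ _ hbound).trans ?_)
    rw [nsmul_eq_mul]
    exact mul_le_mul_of_nonneg_right (Nat.cast_le.2 hTK) (by positivity)
  -- Twice the distance of the midpoint of the two extreme hits from the centre of the ball.
  have hmid : ∀ U ⊆ T, ‖(∑ i ∈ A U, v i - (c - ∑ i ∈ U, v i))
      + (∑ i ∈ A' U, v i - (c - ∑ i ∈ U, v i))‖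
      ≤ √((2 * r) ^ 2 - (((s : ℝ) - 1) / (1 + β)) ^ 2) := by
    intro U hU
    refine norm_add_sub_le_of_hits hβ0 (by
        have : (1 : ℝ) ≤ s := by exact_mod_cast hs1
        linarith) (mem_hits.1 (hA U hU)).2 (mem_hits.1 (hA' U hU)).2 ?_
    refine le_trans ?_ (card_sdiff_le_mul_norm_sub he hβ0 hv hev hG
      (mem_hits.1 (hA' U hU)).1 (hAA' U hU) _)
    have : (s : ℝ) ≤ ((A' U \ A U).card : ℝ) + 1 := by exact_mod_cast hcard U hU
    linarith
  have hfin : 2 * ‖perp e w‖ ≤ 2 * √((2 * r) ^ 2 - (((s : ℝ) - 1) / (1 + β)) ^ 2)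
      + 2 * (β * (2 * r + ‖w‖)) := by
    have h1 := hperp (hAC _ hD) (hAC _ hD') (hA _ hD) (hA _ hD')
    have h2 := hperp (hAC' _ hD) (hAC' _ hD') (hA' _ hD) (hA' _ hD')
    have hdecomp : w + w = (((∑ i ∈ A D, v i - (c - ∑ i ∈ D, v i))
          + (∑ i ∈ A' D, v i - (c - ∑ i ∈ D, v i)))
        - ((∑ i ∈ A (T \ D), v i - (c - ∑ i ∈ T \ D, v i))
          + (∑ i ∈ A' (T \ D), v i - (c - ∑ i ∈ T \ D, v i))))
        - ((∑ i ∈ A D, v i - ∑ i ∈ A (T \ D), v i)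
          + (∑ i ∈ A' D, v i - ∑ i ∈ A' (T \ D), v i)) := by
      rw [hw]; abel
    have h3 : 2 * ‖perp e w‖ = ‖perp e (w + w)‖ := by
      rw [map_add, ← two_smul ℝ, norm_smul]; norm_num
    rw [h3, hdecomp, map_sub, map_add (perp e) (∑ i ∈ A D, v i - ∑ i ∈ A (T \ D), v i)]
    refine (norm_sub_le _ _).trans (add_le_add ?_ ?_)
    · refine (norm_perp_le he _).trans ((norm_sub_le _ _).trans ?_)
      have := hmid D hD
      have := hmid _ hD'
      linarith
    · exact (norm_add_le _ _).trans (by linarith)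
  have hlt : √q < ‖perp e w‖ := by
    rw [← hperpw] at hDsum
    have := Real.sqrt_lt_sqrt hq0 (hTq.trans_le hDsum)
    rwa [Real.sqrt_sq (norm_nonneg _)] at this
  have hbw : β * (2 * r + ‖w‖) ≤ β * (2 * r + K * (8 * r / ζ)) :=
    mul_le_mul_of_nonneg_left (by linarith) hβ0
  linarith

theorem card_inter_hits_le {e : E} (he : ‖e‖ = 1) {r β : ℝ} {s : ℕ}
    (hβ0 : 0 ≤ β) (hβs : (1 + β) * (2 * r) < s)
    {v : ι → E} {G : Finset ι} (hv : ∀ i ∈ G, 1 ≤ ‖v i‖)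
    (hev : ∀ i ∈ G, 0 ≤ (inner ℝ e (v i) : ℝ))
    (hG : ∀ i ∈ G, ‖perp e (v i)‖ ≤ β * inner ℝ e (v i)) {C : Finset (Finset ι)}
    (hC : IsChain (· ⊆ ·) (C : Set (Finset ι))) (c : E) :
    (C ∩ hits v G c r).card ≤ s := by
  by_contra! hlt
  obtain ⟨A, hA, A', hA', hAA', hcard⟩ := exists_subset_card_le_card_sdiff_add_one
    (hC.mono (Finset.coe_subset.2 (Finset.inter_subset_left
      (s₂ := hits v G c r)))) (Finset.card_pos.1 (by omega))
  have hA := (Finset.mem_inter.1 hA).2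
  have hA' := (Finset.mem_inter.1 hA').2
  have h1 := card_sdiff_le_mul_norm_sub he hβ0 hv hev hG (mem_hits.1 hA').1 hAA' c
  have h2 : (s : ℝ) ≤ ((A' \ A).card : ℝ) := by exact_mod_cast (by omega)
  have h3 := (norm_sub_le (∑ i ∈ A', v i - c) (∑ i ∈ A, v i - c)).trans
    (add_le_add (mem_hits.1 hA').2 (mem_hits.1 hA).2)
  nlinarith

/-- Summing the loss of one hit per chain over all chains by the weighted LYM inequality: the
vectors of `T` lower the leading constant `s` by at least `2⁻ᴷ`. -/
theorem hitProb_union_le {e : E} (he : ‖e‖ = 1) {r β ζ q : ℝ} {s K : ℕ} (hs1 : 1 ≤ s)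
    (hβ0 : 0 ≤ β) (hβ1 : β ≤ 1) (hζ : 0 < ζ) (hβζ : 2 * β ≤ ζ) (hr : 0 ≤ r) (hq0 : 0 ≤ q)
    (hβs : (1 + β) * (2 * r) < s)
    (hq : √((2 * r) ^ 2 - (((s : ℝ) - 1) / (1 + β)) ^ 2)
      + β * (2 * r + K * (8 * r / ζ)) ≤ √q)
    {v : ι → E} {G T : Finset ι} (hGT : Disjoint G T) (hv : ∀ i ∈ G, 1 ≤ ‖v i‖)
    (hev : ∀ i ∈ G, 0 ≤ (inner ℝ e (v i) : ℝ))
    (hG : ∀ i ∈ G, ‖perp e (v i)‖ ≤ β * inner ℝ e (v i))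
    (hT : ∀ i ∈ T, ζ * ‖v i‖ ≤ ‖perp e (v i)‖) (hTK : T.card ≤ K)
    (hTq : q < ∑ i ∈ T, ‖perp e (v i)‖ ^ 2) (c : E) :
    hitProb v (G ∪ T) c r ≤ middleProb G.card * (s - (2 ^ K : ℝ)⁻¹) := by
  have hmain := sum_le_choose_middle_mul_of_isChain G
    (fun A => ∑ D ∈ T.powerset, if A ∈ hits v G (c - ∑ i ∈ D, v i) r then (1 : ℝ) else 0)
    (fun A => Finset.sum_nonneg fun D _ => by split_ifs <;> norm_num) (2 ^ T.card * s - 1) (by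
    intro C _ hC
    rw [Finset.sum_comm]
    obtain ⟨D, hD, hlt⟩ := exists_card_filter_hits_lt he hs1 hβ0 hβ1 hζ hβζ hr hq0 hq hv hev hG hT hTK
      hTq hC c
    have h1 : ∑ D ∈ T.powerset, (C ∩ hits v G (c - ∑ i ∈ D, v i) r).card
        < ∑ D ∈ T.powerset, s :=
      Finset.sum_lt_sum (fun D _ => card_inter_hits_le he hβ0 hβs hv hev hG hC _)
        ⟨D, Finset.mem_powerset.2 hD, hlt⟩
    rw [Finset.sum_const, Finset.card_powerset, smul_eq_mul] at h1
    have h2 : ∑ D ∈ T.powerset, ∑ A ∈ C, (if A ∈ hits v G (c - ∑ i ∈ D, v i) r then (1 : ℝ) else 0)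
        = ((∑ D ∈ T.powerset, (C ∩ hits v G (c - ∑ i ∈ D, v i) r).card : ℕ) : ℝ) := by
      push_cast
      refine Finset.sum_congr rfl fun D _ => ?_
      rw [Finset.sum_ite_mem, Finset.sum_const, nsmul_eq_mul, mul_one]
    rw [h2, le_sub_iff_add_le]
    exact_mod_cast h1)
  rw [Finset.sum_comm] at hmain
  have hcard : ((hits v (G ∪ T) c r).card : ℝ) = ∑ D ∈ T.powerset, ∑ A ∈ G.powerset,
      if A ∈ hits v G (c - ∑ i ∈ D, v i) r then (1 : ℝ) else 0 := by
    rw [card_hits_union v hGT]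
    push_cast
    refine Finset.sum_congr rfl fun D _ => ?_
    rw [Finset.sum_ite_mem, Finset.inter_eq_right.2
      (fun A hA => Finset.mem_powerset.2 (mem_hits.1 hA).1), Finset.sum_const, nsmul_eq_mul,
      mul_one]
  rw [← hcard] at hmain
  rw [hitProb, Finset.card_union_of_disjoint hGT, div_le_iff₀ (by positivity), middleProb, pow_add]
  refine hmain.trans ?_
  have h3 : (2 : ℝ) ^ T.card ≤ 2 ^ K := pow_le_pow_right₀ (by norm_num) hTK
  have h4 : (2 : ℝ) ^ T.card * (2 ^ K)⁻¹ ≤ 1 := by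
    rw [← div_eq_mul_inv]; exact div_le_one_of_le₀ h3 (by positivity)
  have h5 : (G.card.choose (G.card / 2) : ℝ) / 2 ^ G.card * (s - (2 ^ K : ℝ)⁻¹)
      * (2 ^ G.card * 2 ^ T.card)
      = (G.card.choose (G.card / 2) : ℝ) * (2 ^ T.card * s - 2 ^ T.card * (2 ^ K)⁻¹) := by
    field_simp
  rw [h5]
  exact mul_le_mul_of_nonneg_left (by linarith) (Nat.cast_nonneg _)

end Gain

/-! ### Two transversal directions -/

section Transversal

variable {E : Type*} [NormedAddCommGroup E] [InnerProductSpace ℝ E] {ι : Type*} [DecidableEq ι]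

/-- Vectors `y`, `w` pointing approximately in the directions `±e`, `±f`, which span different
lines, cannot cancel. -/
theorem mul_add_le_norm_add {e f : E} (he : ‖e‖ = 1) (hf : ‖f‖ = 1) {β : ℝ}
    (hef : |inner ℝ e f| ≤ 1 - 8 * β ^ 2) {y w : E} {Y W : ℝ}
    (hy : ‖y - Y • e‖ ≤ β * |Y|) (hw : ‖w - W • f‖ ≤ β * |W|) :
    β * (|Y| + |W|) ≤ ‖y + w‖ := by
  have h1 : 2 * β * (|Y| + |W|) ≤ ‖Y • e + W • f‖ := by
    refine le_of_sq_le_sq ?_ (norm_nonneg _)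
    rw [norm_add_sq_real, norm_smul, norm_smul, he, hf, real_inner_smul_left,
      real_inner_smul_right, mul_one, mul_one, Real.norm_eq_abs, Real.norm_eq_abs]
    have h2 : -(|Y| * |W| * (1 - 8 * β ^ 2)) ≤ Y * (W * inner ℝ e f) := by
      have h3 : |Y * (W * inner ℝ e f)| ≤ |Y| * |W| * (1 - 8 * β ^ 2) := by
        rw [abs_mul, abs_mul, ← mul_assoc]
        exact mul_le_mul_of_nonneg_left hef (by positivity)
      exact neg_le_of_abs_le h3
    have h4 : 0 ≤ 1 - 8 * β ^ 2 := (abs_nonneg _).trans hef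
    nlinarith [mul_nonneg h4 (sq_nonneg (|Y| - |W|)), sq_nonneg (|Y| - |W|),
      mul_nonneg (sq_nonneg β) (sq_nonneg (|Y| - |W|))]
  have h2 : ‖Y • e + W • f‖ ≤ ‖y + w‖ + ‖y - Y • e‖ + ‖w - W • f‖ := by
    have : Y • e + W • f = (y + w) - (y - Y • e) - (w - W • f) := by abel
    rw [this]
    exact (norm_sub_le _ _).trans (add_le_add (norm_sub_le _ _) le_rfl)
  linarith

theorem exists_norm_sum_sub_sum_sub_smul_le {e : E} {β : ℝ} {v : ι → E} {G : Finset ι}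
    (hv : ∀ i ∈ G, 1 ≤ ‖v i‖) (hG : ∀ i ∈ G, ‖v i - ‖v i‖ • e‖ ≤ β * ‖v i‖) {A A' : Finset ι}
    (hA : A ⊆ G) (hA' : A' ⊆ G) (h : A ⊆ A' ∨ A' ⊆ A) :
    ∃ Y : ℝ, ((A' \ A).card : ℝ) ≤ |Y| ∧
      ‖(∑ i ∈ A', v i - ∑ i ∈ A, v i) - Y • e‖ ≤ β * |Y| := by
  have key : ∀ {B : Finset ι}, B ⊆ G → (B.card : ℝ) ≤ ∑ i ∈ B, ‖v i‖ ∧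
      ‖∑ i ∈ B, v i - (∑ i ∈ B, ‖v i‖) • e‖ ≤ β * ∑ i ∈ B, ‖v i‖ := by
    intro B hB
    constructor
    · calc (B.card : ℝ) = ∑ i ∈ B, (1 : ℝ) := by simp
        _ ≤ _ := Finset.sum_le_sum fun i hi => hv i (hB hi)
    · rw [Finset.sum_smul, ← Finset.sum_sub_distrib, Finset.mul_sum]
      exact (norm_sum_le _ _).trans (Finset.sum_le_sum fun i hi => hG i (hB hi))
  have hpos : ∀ B : Finset ι, |∑ i ∈ B, ‖v i‖| = ∑ i ∈ B, ‖v i‖ := fun B =>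
    abs_of_nonneg (Finset.sum_nonneg fun i _ => norm_nonneg _)
  rcases h with h | h
  · refine ⟨∑ i ∈ A' \ A, ‖v i‖, ?_⟩
    rw [hpos, ← Finset.sum_sdiff h, add_sub_cancel_right]
    exact key (Finset.sdiff_subset.trans hA')
  · refine ⟨-∑ i ∈ A \ A', ‖v i‖, ?_⟩
    rw [abs_neg, hpos, ← Finset.sum_sdiff h, Finset.sdiff_eq_empty_iff_subset.2 h]
    obtain ⟨-, h2⟩ := key ((Finset.sdiff_subset (s := A) (t := A')).trans hA)
    refine ⟨by simpa using Finset.sum_nonneg fun i _ => norm_nonneg _, ?_⟩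
    rw [neg_smul, sub_add_cancel_right, ← neg_sub', norm_neg]
    exact h2

theorem card_le_of_isChain_of_card_sdiff_le {C : Finset (Finset ι)}
    (hC : IsChain (· ⊆ ·) (C : Set (Finset ι))) {R : ℝ} (hR : 0 ≤ R)
    (h : ∀ A ∈ C, ∀ A' ∈ C, ((A' \ A).card : ℝ) ≤ R) : (C.card : ℝ) ≤ R + 1 := by
  rcases C.eq_empty_or_nonempty with rfl | hne
  · simp only [Finset.card_empty, Nat.cast_zero]; linarith
  · obtain ⟨A, hA, A', hA', -, hcard⟩ := exists_subset_card_le_card_sdiff_add_one hC hne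
    have : (C.card : ℝ) ≤ ((A' \ A).card : ℝ) + 1 := by exact_mod_cast hcard
    linarith [h A hA A' hA']

/-- Two families of vectors in transversal directions give a genuinely two-dimensional walk: a
product of two chains has boundedly many hits. -/
theorem hitProb_union_le_mul_middleProb {e f : E} (he : ‖e‖ = 1) (hf : ‖f‖ = 1) {β r : ℝ}
    (hβ : 0 < β) (hr : 0 ≤ r) (hef : |inner ℝ e f| ≤ 1 - 8 * β ^ 2) {v : ι → E}
    {G H : Finset ι} (hGH : Disjoint G H) (hvG : ∀ i ∈ G, 1 ≤ ‖v i‖) (hvH : ∀ i ∈ H, 1 ≤ ‖v i‖)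
    (hG : ∀ i ∈ G, ‖v i - ‖v i‖ • e‖ ≤ β * ‖v i‖)
    (hH : ∀ i ∈ H, ‖v i - ‖v i‖ • f‖ ≤ β * ‖v i‖) (c : E) :
    hitProb v (G ∪ H) c r
      ≤ (2 * r / β + 1) ^ 2 * (middleProb G.card * middleProb H.card) := by
  have hR : 0 ≤ 2 * r / β := by positivity
  have hmain := sum_sum_le_choose_middle_mul_of_isChain G H
    (fun A B => if A ∈ hits v G (c - ∑ i ∈ B, v i) r then (1 : ℝ) else 0)
    (fun A B => by split_ifs <;> norm_num) ((2 * r / β + 1) ^ 2) (by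
    intro C hC hCc D hD hDc
    -- `P` is the set of hits in the product of the two chains; both projections are short chains.
    let P := (C ×ˢ D).filter fun x => x.1 ∈ hits v G (c - ∑ i ∈ x.2, v i) r
    have hP : ∀ x ∈ P, ∀ x' ∈ P, ((x'.1 \ x.1).card : ℝ) ≤ 2 * r / β ∧
        ((x'.2 \ x.2).card : ℝ) ≤ 2 * r / β := by
      intro x hx x' hx'
      obtain ⟨hx1, hx2⟩ := Finset.mem_filter.1 hx
      obtain ⟨hx1', hx2'⟩ := Finset.mem_filter.1 hx'
      obtain ⟨hxC, hxD⟩ := Finset.mem_product.1 hx1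
      obtain ⟨hxC', hxD'⟩ := Finset.mem_product.1 hx1'
      obtain ⟨Y, hY, hYn⟩ := exists_norm_sum_sub_sum_sub_smul_le hvG hG
        (Finset.mem_powerset.1 (hC hxC)) (Finset.mem_powerset.1 (hC hxC')) (hCc.total hxC hxC')
      obtain ⟨W, hW, hWn⟩ := exists_norm_sum_sub_sum_sub_smul_le hvH hH
        (Finset.mem_powerset.1 (hD hxD)) (Finset.mem_powerset.1 (hD hxD')) (hDc.total hxD hxD')
      have h1 := mul_add_le_norm_add he hf hef hYn hWn
      have h2 : ‖(∑ i ∈ x'.1, v i - ∑ i ∈ x.1, v i) + (∑ i ∈ x'.2, v i - ∑ i ∈ x.2, v i)‖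
          ≤ 2 * r := by
        have : (∑ i ∈ x'.1, v i - ∑ i ∈ x.1, v i) + (∑ i ∈ x'.2, v i - ∑ i ∈ x.2, v i)
            = (∑ i ∈ x'.1, v i - (c - ∑ i ∈ x'.2, v i))
              - (∑ i ∈ x.1, v i - (c - ∑ i ∈ x.2, v i)) := by abel
        rw [this]
        exact (norm_sub_le _ _).trans
          (by linarith [(mem_hits.1 hx2).2, (mem_hits.1 hx2').2])
      have hsum : |Y| + |W| ≤ 2 * r / β := by rw [le_div_iff₀ hβ]; linarith
      constructor
      · linarith [abs_nonneg W]
      · linarith [abs_nonneg Y]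
    have hP1 : ((P.image Prod.fst).card : ℝ) ≤ 2 * r / β + 1 := by
      refine card_le_of_isChain_of_card_sdiff_le (hCc.mono ?_) hR ?_
      · intro A hA
        obtain ⟨x, hx, rfl⟩ := Finset.mem_image.1 hA
        exact (Finset.mem_product.1 (Finset.mem_filter.1 hx).1).1
      · intro A hA A' hA'
        obtain ⟨x, hx, rfl⟩ := Finset.mem_image.1 hA
        obtain ⟨x', hx', rfl⟩ := Finset.mem_image.1 hA'
        exact (hP x hx x' hx').1
    have hP2 : ((P.image Prod.snd).card : ℝ) ≤ 2 * r / β + 1 := by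
      refine card_le_of_isChain_of_card_sdiff_le (hDc.mono ?_) hR ?_
      · intro A hA
        obtain ⟨x, hx, rfl⟩ := Finset.mem_image.1 hA
        exact (Finset.mem_product.1 (Finset.mem_filter.1 hx).1).2
      · intro A hA A' hA'
        obtain ⟨x, hx, rfl⟩ := Finset.mem_image.1 hA
        obtain ⟨x', hx', rfl⟩ := Finset.mem_image.1 hA'
        exact (hP x hx x' hx').2
    have hPcard : (P.card : ℝ) ≤ ((P.image Prod.fst).card : ℝ) * (P.image Prod.snd).card := by
      rw [← Nat.cast_mul, ← Finset.card_product]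
      exact Nat.cast_le.2 (Finset.card_le_card Finset.subset_product)
    rw [← Finset.sum_product', ← Finset.sum_filter, Finset.sum_const, nsmul_eq_mul, mul_one]
    refine hPcard.trans ?_
    rw [sq]
    exact mul_le_mul hP1 hP2 (Nat.cast_nonneg _) (by linarith))
  rw [Finset.sum_comm] at hmain
  have hcard : ((hits v (G ∪ H) c r).card : ℝ) = ∑ D ∈ H.powerset, ∑ A ∈ G.powerset,
      if A ∈ hits v G (c - ∑ i ∈ D, v i) r then (1 : ℝ) else 0 := by
    rw [card_hits_union v hGH]
    push_cast
    refine Finset.sum_congr rfl fun D _ => ?_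
    rw [Finset.sum_ite_mem, Finset.inter_eq_right.2
      (fun A hA => Finset.mem_powerset.2 (mem_hits.1 hA).1), Finset.sum_const, nsmul_eq_mul,
      mul_one]
  rw [← hcard] at hmain
  rw [hitProb, Finset.card_union_of_disjoint hGH, div_le_iff₀ (by positivity), middleProb,
    middleProb, pow_add]
  refine hmain.trans (le_of_eq ?_)
  field_simp

end Transversal

/-! ### Finding the main direction -/

section Direction

variable {E : Type*} [NormedAddCommGroup E] [InnerProductSpace ℝ E]

theorem norm_perp_le_of_norm_sub_smul_le {e f : E} (he : ‖e‖ = 1) (hf : ‖f‖ = 1) {β : ℝ}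
    (hβ : 0 ≤ β) (hef : 1 - 8 * β ^ 2 ≤ |inner ℝ e f|) (hβ1 : 8 * β ^ 2 ≤ 1) {v : E}
    (hv : ‖v - ‖v‖ • f‖ ≤ β * ‖v‖) :
    ‖perp e v‖ ≤ 5 * β * ‖v‖ := by
  have h1 : ‖perp e f‖ ≤ 4 * β := by
    refine le_of_sq_le_sq ?_ (by positivity)
    have h2 := norm_sq_eq_sq_add_norm_perp_sq he f
    have h3 : (1 - 8 * β ^ 2) ^ 2 ≤ (inner ℝ e f : ℝ) ^ 2 := by
      rw [← sq_abs (inner ℝ e f : ℝ)]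
      exact pow_le_pow_left₀ (by linarith) hef 2
    rw [hf] at h2
    nlinarith [sq_nonneg (β ^ 2)]
  have h2 : perp e v = perp e (v - ‖v‖ • f) + ‖v‖ • perp e f := by
    rw [← map_smul, ← map_add, sub_add_cancel]
  rw [h2]
  refine (norm_add_le _ _).trans ?_
  rw [norm_smul, norm_norm]
  have h3 := norm_perp_le he (v - ‖v‖ • f)
  nlinarith [norm_nonneg v]

theorem exists_finite_cover_sphere [FiniteDimensional ℝ E] {β : ℝ} (hβ : 0 < β) :
    ∃ t : Finset E, (∀ e ∈ t, ‖e‖ = 1) ∧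
      ∀ v : E, v ≠ 0 → ∃ e ∈ t, ‖v - ‖v‖ • e‖ ≤ β * ‖v‖ := by
  obtain ⟨t, hts, htf, ht⟩ := (isCompact_sphere (0 : E) 1).finite_cover_balls hβ
  refine ⟨htf.toFinset, fun e he => by simpa using hts (htf.mem_toFinset.1 he), fun v hv => ?_⟩
  have hv0 : 0 < ‖v‖ := norm_pos_iff.2 hv
  have hu : ‖v‖⁻¹ • v ∈ Metric.sphere (0 : E) 1 := by
    simp [norm_smul, hv0.ne']
  obtain ⟨e, he, hue⟩ := Set.mem_iUnion₂.1 (ht hu)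
  refine ⟨e, htf.mem_toFinset.2 he, ?_⟩
  rw [Metric.mem_ball, dist_eq_norm] at hue
  have h1 : v - ‖v‖ • e = ‖v‖ • (‖v‖⁻¹ • v - e) := by
    rw [smul_sub, smul_smul, mul_inv_cancel₀ hv0.ne', one_smul]
  rw [h1, norm_smul, norm_norm, mul_comm]
  exact mul_le_mul_of_nonneg_right hue.le hv0.le

/-- Either a positive proportion of the vectors is spread over each of two transversal
directions, or almost all of them are nearly parallel to one direction. -/
theorem exists_transversal_or_exists_direction [FiniteDimensional ℝ E] {β : ℝ} (hβ : 0 < β)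
    (hβ1 : 8 * β ^ 2 ≤ 1) : ∃ N : ℕ, 0 < N ∧ ∀ (κ : ℝ), 0 < κ → N * κ ≤ 1 →
      ∀ {ι : Type} [Fintype ι] [Nonempty ι] (v : ι → E), (∀ i, 1 ≤ ‖v i‖) →
      (∃ (e f : E) (G H : Finset ι), ‖e‖ = 1 ∧ ‖f‖ = 1 ∧ |inner ℝ e f| ≤ 1 - 8 * β ^ 2 ∧
        Disjoint G H ∧ κ * Fintype.card ι ≤ G.card ∧ κ * Fintype.card ι ≤ H.card ∧
        (∀ i ∈ G, ‖v i - ‖v i‖ • e‖ ≤ β * ‖v i‖) ∧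
        ∀ i ∈ H, ‖v i - ‖v i‖ • f‖ ≤ β * ‖v i‖) ∨
      ∃ (e : E) (G : Finset ι), ‖e‖ = 1 ∧ (1 - N * κ) * Fintype.card ι ≤ G.card ∧
        ∀ i ∈ G, ‖perp e (v i)‖ ≤ 5 * β * ‖v i‖ := by
  classical
  obtain ⟨t, ht1, ht⟩ := exists_finite_cover_sphere (E := E) hβ
  -- `t` may be empty when the space is trivial, hence the additional `1`.
  refine ⟨t.card + 1, Nat.succ_pos _, ?_⟩
  intro κ hκ hNκ ι _ _ v hv
  push_cast at hNκ ⊢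
  have hcell : ∀ i, ∃ e ∈ t, ‖v i - ‖v i‖ • e‖ ≤ β * ‖v i‖ := fun i =>
    ht (v i) (norm_pos_iff.1 (by linarith [hv i]))
  choose g hgt hg using hcell
  have htne : t.Nonempty := ⟨g (Classical.arbitrary ι), hgt _⟩
  have hn0 : (0 : ℝ) ≤ Fintype.card ι := Nat.cast_nonneg _
  -- `e` is the centre of a cell that holds many vectors.
  obtain ⟨e, het, he⟩ := Finset.exists_le_card_fiber_of_nsmul_le_card_of_maps_to
    (s := (Finset.univ : Finset ι)) (t := t) (f := g) (b := κ * Fintype.card ι)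
    (fun i _ => hgt i) htne (by
      rw [nsmul_eq_mul, Finset.card_univ]
      nlinarith)
  by_cases hfar : ∃ f ∈ t, |inner ℝ e f| ≤ 1 - 8 * β ^ 2 ∧
      κ * Fintype.card ι ≤ ((Finset.univ.filter fun i => g i = f).card : ℝ)
  · obtain ⟨f, hft, hef, hf⟩ := hfar
    left
    refine ⟨e, f, _, _, ht1 e het, ht1 f hft, hef, ?_, he, hf, ?_, ?_⟩
    · rw [Finset.disjoint_filter]
      rintro i - h1 h2
      rw [← h1.symm.trans h2, real_inner_self_eq_norm_sq, ht1 e het] at hef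
      norm_num at hef
      nlinarith
    · intro i hi
      exact (Finset.mem_filter.1 hi).2 ▸ hg i
    · intro i hi
      exact (Finset.mem_filter.1 hi).2 ▸ hg i
  · push Not at hfar
    right
    refine ⟨e, Finset.univ.filter fun i => ‖perp e (v i)‖ ≤ 5 * β * ‖v i‖, ht1 e het, ?_,
      fun i hi => (Finset.mem_filter.1 hi).2⟩
    set G := Finset.univ.filter fun i => ‖perp e (v i)‖ ≤ 5 * β * ‖v i‖ with hG
    have hsub : Gᶜ ⊆ (t.filter fun f => |inner ℝ e f| ≤ 1 - 8 * β ^ 2).biUnion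
        fun f => Finset.univ.filter fun i => g i = f := by
      intro i hi
      refine Finset.mem_biUnion.2 ⟨g i, Finset.mem_filter.2 ⟨hgt i, ?_⟩, by simp⟩
      by_contra! hlt
      refine Finset.mem_compl.1 hi (Finset.mem_filter.2 ⟨Finset.mem_univ _, ?_⟩)
      exact norm_perp_le_of_norm_sub_smul_le (ht1 e het) (ht1 _ (hgt i)) hβ.le hlt.le hβ1 (hg i)
    have hcompl : (Gᶜ.card : ℝ) ≤ t.card * (κ * Fintype.card ι) := by
      calc (Gᶜ.card : ℝ) ≤ ∑ f ∈ t.filter fun f => |inner ℝ e f| ≤ 1 - 8 * β ^ 2,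
            ((Finset.univ.filter fun i => g i = f).card : ℝ) := by
            exact_mod_cast (Finset.card_le_card hsub).trans Finset.card_biUnion_le
        _ ≤ ∑ f ∈ t.filter fun f => |inner ℝ e f| ≤ 1 - 8 * β ^ 2, κ * Fintype.card ι := by
            refine Finset.sum_le_sum fun f hf => ?_
            obtain ⟨h1, h2⟩ := Finset.mem_filter.1 hf
            exact (hfar f h1 h2).le
        _ ≤ t.card * (κ * Fintype.card ι) := by
            rw [Finset.sum_const, nsmul_eq_mul]
            exact mul_le_mul_of_nonneg_right (Nat.cast_le.2 (Finset.card_filter_le _ _))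
              (by positivity)
    have hadd : (G.card : ℝ) + (Gᶜ.card : ℝ) = Fintype.card ι := by
      exact_mod_cast Finset.card_add_card_compl G
    nlinarith [mul_nonneg hκ.le hn0]

end Direction

/-! ### The upper bound -/

section UpperBound

variable {E : Type*} [NormedAddCommGroup E] [InnerProductSpace ℝ E]

/-- `η` bounds the angles that are neglected and `β` is the width of the main cone. They exist by
continuity: when both tend to `0`, suitably coupled, the two sides of the last inequality tend to
`√((2 * r) ^ 2 - (s - 1) ^ 2) < 1` and to `1`. -/
theorem exists_gain_constants {s : ℕ} (hs1 : 1 ≤ s) {r : ℝ}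
    (hr : (2 * r) ^ 2 < ((s : ℝ) - 1) ^ 2 + 1) :
    ∃ η β : ℝ, 0 < η ∧ 0 < β ∧ β ≤ 1 ∧ 2 * β ≤ √η ∧ (1 + β) * (2 * r) < s ∧
      0 ≤ 1 - (s + 1) * η ∧ √((2 * r) ^ 2 - (((s : ℝ) - 1) / (1 + β)) ^ 2)
        + β * (2 * r + (s + 1 : ℕ) * (8 * r / √η)) ≤ √(1 - (s + 1) * η) := by
  have hs : (1 : ℝ) ≤ s := by exact_mod_cast hs1
  have hrs : 2 * r < s := lt_of_pow_lt_pow_left₀ 2 (by positivity) (by nlinarith)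
  set δ := (2 * r) ^ 2 - ((s : ℝ) - 1) ^ 2 with hδ
  obtain ⟨q, hq1, hq2⟩ : ∃ q, max δ 0 < q ∧ q < 1 :=
    exists_between (max_lt (by linarith) one_pos)
  have hq0 : 0 < q := (le_max_right _ _).trans_lt hq1
  have hη : 0 < (1 - q) / (s + 1) := by
    have : 0 < 1 - q := by linarith
    positivity
  have hqη : 1 - (s + 1) * ((1 - q) / (s + 1)) = q := by field_simp; ring
  have hlt : √δ < √q := Real.sqrt_lt_sqrt_iff_of_pos hq0 |>.2 ((le_max_left _ _).trans_lt hq1)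
  have hcont : ContinuousAt (fun β : ℝ => √((2 * r) ^ 2 - (((s : ℝ) - 1) / (1 + β)) ^ 2)
        + β * (2 * r + (s + 1 : ℕ) * (8 * r / √((1 - q) / (s + 1))))) 0 := by
    have h1 : ContinuousAt (fun β : ℝ => ((s : ℝ) - 1) / (1 + β)) 0 :=
      continuousAt_const.div (continuousAt_const.add continuousAt_id) (by norm_num)
    exact ((continuousAt_const.sub (h1.pow 2)).sqrt).add (continuousAt_id.mul continuousAt_const)
  have hev1 : ∀ᶠ β in nhds (0 : ℝ), √((2 * r) ^ 2 - (((s : ℝ) - 1) / (1 + β)) ^ 2)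
        + β * (2 * r + (s + 1 : ℕ) * (8 * r / √((1 - q) / (s + 1)))) < √q :=
    hcont.eventually_lt_const (by simpa using hlt)
  have hev2 : ∀ᶠ β in nhds (0 : ℝ), (1 + β) * (2 * r) < s :=
    ((continuousAt_const.add continuousAt_id).mul continuousAt_const).eventually_lt_const
      (by simpa using hrs)
  have hev3 : ∀ᶠ β in nhds (0 : ℝ), 2 * β < √((1 - q) / (s + 1)) :=
    (continuousAt_const.mul continuousAt_id).eventually_lt_const (by simpa using hη)
  have hev4 : ∀ᶠ β in nhds (0 : ℝ), β < 1 := eventually_lt_nhds one_pos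
  obtain ⟨β, ⟨⟨⟨h1, h2⟩, h3⟩, h4⟩, hβ⟩ := ((((hev1.and hev2).and hev3).and hev4).filter_mono
    (nhdsWithin_le_nhds (s := Set.Ioi 0)) |>.and self_mem_nhdsWithin).exists
  refine ⟨(1 - q) / (s + 1), β, hη, hβ, h4.le, h3.le, h2, ?_, ?_⟩
  · rw [hqη]; exact hq0.le
  · rw [hqη]; exact h1.le

/-- If most vectors are nearly parallel to `e`, then either the angles are small enough for the
chain argument, or a bounded number of exceptional vectors yields a gain. -/
theorem hitProb_le_or_hitProb_le {e : E} (he : ‖e‖ = 1) {s : ℕ} (hs1 : 1 ≤ s) {r η β : ℝ}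
    (hr0 : 0 ≤ r) (hr : (2 * r) ^ 2 < ((s : ℝ) - 1) ^ 2 + 1) (hη : 0 < η) (hβ : 0 < β)
    (hβ1 : β ≤ 1) (hβη : 2 * β ≤ √η) (hβs : (1 + β) * (2 * r) < s) (hq0 : 0 ≤ 1 - (s + 1) * η)
    (hq : √((2 * r) ^ 2 - (((s : ℝ) - 1) / (1 + β)) ^ 2)
        + β * (2 * r + (s + 1 : ℕ) * (8 * r / √η)) ≤ √(1 - (s + 1) * η))
    {ι : Type*} [Fintype ι] [DecidableEq ι] (hsι : s ≤ Fintype.card ι) {v : ι → E}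
    (hv : ∀ i, 1 ≤ ‖v i‖) (hev : ∀ i, 0 ≤ (inner ℝ e (v i) : ℝ)) {G : Finset ι}
    (hG : ∀ i ∈ G, ‖perp e (v i)‖ ≤ β / 2 * ‖v i‖) (c : E) :
    hitProb v Finset.univ c r ≤ (2 ^ Fintype.card ι : ℝ)⁻¹ * largestBinomSum (Fintype.card ι) s ∨
      hitProb v Finset.univ c r ≤ middleProb G.card * (s - (2 ^ (s + 1) : ℝ)⁻¹) := by
  by_cases hx : ∀ U : Finset ι, U.card ≤ s + 1 → ∑ i ∈ U, sinSq e (v i) ≤ 1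
  · left
    have := card_hits_le_largestBinomSum he v Finset.univ hs1 (by simpa using hsι) hr hr0
      (fun i _ => hv i) (fun i _ => hev i) (fun U _ => hx U) c
    rw [hitProb, Finset.card_univ, div_eq_inv_mul]
    rw [Finset.card_univ] at this
    exact mul_le_mul_of_nonneg_left (Nat.cast_le.2 this) (by positivity)
  · right
    push Not at hx
    obtain ⟨U, hUs, hU⟩ := hx
    have hζ : 0 < √η := Real.sqrt_pos.2 hη
    -- Only the vectors with substantial angles are kept; the others contribute at most
    -- `(s + 1) * η`.
    set T := U.filter fun i => η ≤ sinSq e (v i) with hT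
    have hnorm : ∀ i, 0 < ‖v i‖ := fun i => by linarith [hv i]
    have hTU : T.card ≤ s + 1 := (Finset.card_filter_le _ _).trans hUs
    have hTζ : ∀ i ∈ T, √η * ‖v i‖ ≤ ‖perp e (v i)‖ := by
      intro i hi
      have h1 := (Finset.mem_filter.1 hi).2
      rw [sinSq, le_div_iff₀ (by have := hnorm i; positivity)] at h1
      refine le_of_sq_le_sq ?_ (norm_nonneg _)
      rwa [mul_pow, Real.sq_sqrt hη.le]
    have hGT : Disjoint G T := by
      refine Finset.disjoint_left.2 fun i hiG hiT => ?_
      nlinarith [hG i hiG, hTζ i hiT, hnorm i]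
    have hGβ : ∀ i ∈ G, ‖perp e (v i)‖ ≤ β * inner ℝ e (v i) := by
      intro i hi
      have h1 := pow_le_pow_left₀ (norm_nonneg _) (hG i hi) 2
      have h2 := norm_sq_eq_sq_add_norm_perp_sq he (v i)
      refine le_of_sq_le_sq ?_ (mul_nonneg hβ.le (hev i))
      rw [mul_pow] at h1 ⊢
      have h3 : β ^ 2 ≤ 1 := pow_le_one₀ hβ.le hβ1
      have h4 : ‖perp e (v i)‖ ^ 2 * β ^ 2 ≤ ‖perp e (v i)‖ ^ 2 * 1 :=
        mul_le_mul_of_nonneg_left h3 (sq_nonneg _)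
      nlinarith
    have hsum : 1 - (s + 1) * η < ∑ i ∈ T, ‖perp e (v i)‖ ^ 2 := by
      have h1 : ∑ i ∈ T, sinSq e (v i) ≤ ∑ i ∈ T, ‖perp e (v i)‖ ^ 2 := by
        refine Finset.sum_le_sum fun i _ => div_le_self (sq_nonneg _) ?_
        exact one_le_pow₀ (hv i)
      have h2 : ∑ i ∈ U.filter (fun i => ¬ η ≤ sinSq e (v i)), sinSq e (v i) ≤ (s + 1) * η := by
        refine (Finset.sum_le_card_nsmul _ _ η fun i hi =>
          (not_le.1 (Finset.mem_filter.1 hi).2).le).trans ?_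
        rw [nsmul_eq_mul]
        refine mul_le_mul_of_nonneg_right ?_ hη.le
        exact_mod_cast (Finset.card_filter_le _ _).trans hUs
      have h3 := Finset.sum_filter_add_sum_filter_not U (fun i => η ≤ sinSq e (v i))
        (fun i => sinSq e (v i))
      linarith
    exact hitProb_le_of_subset v (Finset.subset_univ (G ∪ T))
      (fun c => hitProb_union_le he hs1 hβ.le hβ1 hζ hβη hr0 hq0 hβs hq hGT (fun i _ => hv i)
        (fun i _ => hev i) hGβ hTζ hTU hsum c) c

/-- The upper bound for the small ball probability, uniformly in the vectors and the ball. -/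
theorem eventually_hitProb_le [FiniteDimensional ℝ E] {s : ℕ} (hs1 : 1 ≤ s) {r : ℝ}
    (hr0 : 0 ≤ r) (hr : (2 * r) ^ 2 < ((s : ℝ) - 1) ^ 2 + 1) :
    ∀ᶠ n : ℕ in atTop, ∀ v : Fin n → E, (∀ i, 1 ≤ ‖v i‖) → ∀ c,
      hitProb v Finset.univ c r ≤ (2 ^ n : ℝ)⁻¹ * largestBinomSum n s := by
  obtain ⟨η, β, hη, hβ, hβ1, hβη, hβs, hq0, hq⟩ := exists_gain_constants hs1 hr
  obtain ⟨N, hN, hdir⟩ := exists_transversal_or_exists_direction (E := E) (β := β / 10)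
    (by positivity) (by nlinarith)
  have hs : (1 : ℝ) ≤ s := by exact_mod_cast hs1
  have hN' : (0 : ℝ) < N := by exact_mod_cast hN
  -- `a` is chosen so that `a * (s - 2 ^ -(s + 1)) = θ * s` with `1 < a` and `θ < 1`.
  set g : ℝ := (2 ^ (s + 1) : ℝ)⁻¹ with hg
  have hg0 : 0 < g := by positivity
  have hg1 : g ≤ 1 / 2 := by
    rw [hg, one_div]
    exact inv_anti₀ two_pos (le_self_pow₀ one_le_two (Nat.succ_ne_zero s))
  have hsg : 0 < s - g := by linarith
  set θ : ℝ := (s - g / 2) / s with hθ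
  have hθ1 : θ < 1 := by rw [hθ, div_lt_one (by linarith)]; linarith
  have hθs : θ * s = s - g / 2 := by rw [hθ]; field_simp
  set a : ℝ := (s - g / 2) / (s - g) with ha
  have ha1 : 1 < a := by rw [ha, one_lt_div hsg]; linarith
  have has : a * (s - g) = θ * s := by rw [hθs, ha]; field_simp
  have ha0 : 0 < a := by linarith
  have hainv : a⁻¹ < 1 := inv_lt_one_of_one_lt₀ ha1
  have hainv0 : 0 < a⁻¹ := by positivity
  set κ : ℝ := (1 - a⁻¹) / N with hκ
  have hκ0 : 0 < κ := div_pos (by linarith) hN'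
  have hNκ : N * κ = 1 - a⁻¹ := by rw [hκ]; field_simp
  set W : ℝ := (2 * r / (β / 10) + 1) ^ 2 * (2 / κ) with hW
  have hW0 : 0 < W := by positivity
  filter_upwards [eventually_ge_atTop s, eventually_le_largestBinomSum hs1 hθ1,
    eventually_middleProb_le ha1,
    tendsto_middleProb.eventually_lt_const (show 0 < θ * s / W by
      have : 0 < θ * s := by linarith
      positivity)] with n hns hlow hmid hsmall v hv c
  have : Nonempty (Fin n) := ⟨⟨0, by omega⟩⟩
  have hcardle : ∀ A : Finset (Fin n), A.card ≤ n := fun A => by simpa using A.card_le_univ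
  rcases hdir κ hκ0 (by linarith) v hv with
    ⟨e, f, G, H, he, hf, hef, hGH, hGc, hHc, hG, hH⟩ | ⟨e, G, he, hGc, hG⟩
  · rw [Fintype.card_fin] at hGc hHc
    refine le_trans ?_ hlow
    refine hitProb_le_of_subset v (Finset.subset_univ (G ∪ H)) (fun c => ?_) c
    refine (hitProb_union_le_mul_middleProb he hf (by positivity) hr0 hef hGH (fun i _ => hv i)
      (fun i _ => hv i) hG hH c).trans ?_
    refine (mul_le_mul_of_nonneg_left (middleProb_mul_middleProb_le hκ0 (by omega) (hcardle G)
      (hcardle H) hGc hHc) (by positivity)).trans ?_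
    rw [← mul_assoc, ← hW, sq, ← mul_assoc]
    refine mul_le_mul_of_nonneg_right ?_ (middleProb_pos n).le
    rw [lt_div_iff₀ hW0] at hsmall
    linarith
  · rw [Fintype.card_fin, hNκ, sub_sub_cancel] at hGc
    classical
    -- Reverse vectors so that all of them lie in the half-space of `e`.
    obtain ⟨c', hc'⟩ := exists_card_hits_le_card_hits_neg v
      (Finset.subset_univ (Finset.univ.filter fun i => (inner ℝ e (v i) : ℝ) < 0)) c r
    set v' : Fin n → E := fun i =>
      if i ∈ Finset.univ.filter fun i => (inner ℝ e (v i) : ℝ) < 0 then -v i else v i with hv'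
    have hv'v : ∀ i, v' i = v i ∨ v' i = -v i := fun i => by
      simp only [hv']; split_ifs <;> simp
    have hnorm : ∀ i, ‖v' i‖ = ‖v i‖ := fun i => by
      rcases hv'v i with h | h <;> simp [h]
    have hperp : ∀ i, ‖perp e (v' i)‖ = ‖perp e (v i)‖ := fun i => by
      rcases hv'v i with h | h <;> simp [h]
    have hpos : ∀ i, 0 ≤ (inner ℝ e (v' i) : ℝ) := fun i => by
      simp only [hv', Finset.mem_filter, Finset.mem_univ, true_and]
      split_ifs with h
      · rw [inner_neg_right]; linarith
      · exact not_lt.1 h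
    have hle : hitProb v Finset.univ c r ≤ hitProb v' Finset.univ c' r :=
      div_le_div_of_nonneg_right (Nat.cast_le.2 hc') (by positivity)
    refine hle.trans ?_
    have hmain := hitProb_le_or_hitProb_le he hs1 hr0 hr hη hβ hβ1 hβη hβs hq0 hq (v := v')
      (by simpa using hns) (fun i => (hnorm i).symm ▸ hv i) hpos (G := G)
      (fun i hi => by rw [hperp, hnorm]; convert hG i hi using 2; ring) c'
    rw [Fintype.card_fin] at hmain
    rcases hmain with h | h
    · exact h
    · refine h.trans (le_trans ?_ hlow)
      rw [← has, mul_right_comm]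
      exact mul_le_mul_of_nonneg_right (hmid G.card (hcardle G) hGc) hsg.le

end UpperBound

/-! ### Random signs and random subsets -/

/-- The sign vector which is `1` on `A` and `-1` off `A`. -/
noncomputable def signVector {n : ℕ} (A : Finset (Fin n)) (i : Fin n) : ℝ :=
  if i ∈ A then 1 else -1

theorem signLaw_eq_sum_dirac (n : ℕ) :
    signLaw n = ∑ A : Finset (Fin n), (2⁻¹ : ENNReal) ^ n • Measure.dirac (signVector A) := by
  refine Measure.pi_eq fun t ht => ?_
  have hber : ∀ i, bernoulliMeasure (1 : ℝ) (-1) ⟨1 / 2, by norm_num, by norm_num⟩ (t i)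
      = 2⁻¹ * (t i).indicator 1 1 + 2⁻¹ * (t i).indicator 1 (-1) := by
    intro i
    have h1 : ((unitInterval.toNNReal ⟨1 / 2, by norm_num, by norm_num⟩ : NNReal) : ENNReal)
        = 2⁻¹ := by
      rw [show unitInterval.toNNReal ⟨1 / 2, by norm_num, by norm_num⟩ = 2⁻¹ by
        ext; simp, ENNReal.coe_inv two_ne_zero, ENNReal.coe_ofNat]
    have h2 : ((unitInterval.toNNReal (unitInterval.symm
        ⟨1 / 2, by norm_num, by norm_num⟩) : NNReal) : ENNReal) = 2⁻¹ := by
      rw [show unitInterval.toNNReal (unitInterval.symm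
        ⟨1 / 2, by norm_num, by norm_num⟩) = 2⁻¹ by
          ext; rw [unitInterval.coe_toNNReal, unitInterval.coe_symm_eq]; norm_num,
        ENNReal.coe_inv two_ne_zero, ENNReal.coe_ofNat]
    rw [bernoulliMeasure_def, Measure.add_apply, Measure.smul_apply, Measure.smul_apply,
      Measure.dirac_apply' _ (ht i), Measure.dirac_apply' _ (ht i), ENNReal.smul_def,
      ENNReal.smul_def, h1, h2, smul_eq_mul, smul_eq_mul]
  simp_rw [hber]
  rw [Finset.prod_add, Measure.finsetSum_apply, Finset.powerset_univ]
  refine Finset.sum_congr rfl fun A _ => ?_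
  rw [Finset.prod_mul_distrib, Finset.prod_mul_distrib, Finset.prod_const, Finset.prod_const,
    mul_mul_mul_comm, ← pow_add, ← Finset.compl_eq_univ_sdiff, Finset.card_add_card_compl,
    Fintype.card_fin, Measure.smul_apply, smul_eq_mul]
  congr 1
  rw [Measure.dirac_apply' _ (MeasurableSet.univ_pi ht)]
  have hprod : ∏ i, (t i).indicator (1 : ℝ → ENNReal) (signVector A i)
      = (∏ i ∈ A, (t i).indicator 1 1) * ∏ i ∈ Aᶜ, (t i).indicator 1 (-1) := by
    rw [← Finset.prod_mul_prod_compl A]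
    congr 1
    · exact Finset.prod_congr rfl fun i hi => by rw [signVector, if_pos hi]
    · exact Finset.prod_congr rfl fun i hi => by
        rw [signVector, if_neg (Finset.mem_compl.1 hi)]
  rw [← hprod]
  by_cases h : signVector A ∈ Set.univ.pi t
  · rw [Set.indicator_of_mem h]
    refine (Finset.prod_eq_one fun i _ => ?_).symm
    rw [Set.indicator_of_mem (h i (Set.mem_univ i))]
    rfl
  · rw [Set.indicator_of_notMem h]
    obtain ⟨i, hi⟩ : ∃ i, signVector A i ∉ t i := by simpa [Set.mem_univ_pi] using h
    exact (Finset.prod_eq_zero (Finset.mem_univ i) (Set.indicator_of_notMem hi _)).symm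

theorem sum_signVector_smul {d n : ℕ} (v : Fin n → EuclideanSpace ℝ (Fin d))
    (A : Finset (Fin n)) :
    ∑ i, signVector A i • v i = (2 : ℝ) • ∑ i ∈ A, v i - ∑ i, v i := by
  have h1 : ∑ i, v i = ∑ i ∈ A, v i + ∑ i ∈ Aᶜ, v i := (Finset.sum_add_sum_compl A v).symm
  have h2 : ∑ i, signVector A i • v i = ∑ i ∈ A, v i + ∑ i ∈ Aᶜ, -v i := by
    rw [← Finset.sum_add_sum_compl A]
    congr 1
    · exact Finset.sum_congr rfl fun i hi => by rw [signVector, if_pos hi, one_smul]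
    · exact Finset.sum_congr rfl fun i hi => by
        rw [signVector, if_neg (Finset.mem_compl.1 hi), neg_one_smul]
  rw [h2, h1, Finset.sum_neg_distrib, two_smul]
  abel

/-- A signed sum is twice a subset sum up to translation, so balls of radius `Δ` become balls of
radius `Δ / 2`. -/
theorem sumProb_closedBall {d n : ℕ} (v : Fin n → EuclideanSpace ℝ (Fin d))
    (x : EuclideanSpace ℝ (Fin d)) (Δ : ℝ) :
    sumProb v (Metric.closedBall x Δ)
      = hitProb v Finset.univ ((2⁻¹ : ℝ) • (x + ∑ i, v i)) (Δ / 2) := by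
  classical
  have hmem : ∀ A : Finset (Fin n), signVector A ∈
      {ξ : Fin n → ℝ | ∑ i, ξ i • v i ∈ Metric.closedBall x Δ} ↔
      A ∈ hits v Finset.univ ((2⁻¹ : ℝ) • (x + ∑ i, v i)) (Δ / 2) := by
    intro A
    rw [Set.mem_ofPred_eq, mem_closedBall_iff_norm, sum_signVector_smul, mem_hits]
    have h1 : (2 : ℝ) • ∑ i ∈ A, v i - ∑ i, v i - x
        = (2 : ℝ) • (∑ i ∈ A, v i - (2⁻¹ : ℝ) • (x + ∑ i, v i)) := by
      rw [smul_sub, smul_smul, mul_inv_cancel₀ two_ne_zero, one_smul]; abel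
    rw [h1, norm_smul, Real.norm_ofNat, le_div_iff₀' two_pos]
    simp
  rw [sumProb, measureReal_def, signLaw_eq_sum_dirac, Measure.finsetSum_apply]
  simp_rw [Measure.smul_apply, Measure.dirac_apply, Set.indicator_apply, hmem, Pi.one_apply,
    smul_eq_mul]
  rw [← Finset.mul_sum, Finset.sum_ite_mem, Finset.univ_inter, Finset.sum_const, nsmul_eq_mul,
    mul_one, hitProb, Finset.card_univ, Fintype.card_fin, ENNReal.toReal_mul, ENNReal.toReal_pow,
    ENNReal.toReal_inv, ENNReal.toReal_ofNat, ENNReal.toReal_natCast, inv_pow, inv_mul_eq_div]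

/-! ### The extremal configuration -/

/-- When all the vectors equal one unit vector, a ball of radius `(s - 1) / 2` can be centred
so as to contain the `s` subset sums that correspond to the central window. -/
theorem exists_largestBinomSum_le_hitProb {E : Type*} [NormedAddCommGroup E]
    [InnerProductSpace ℝ E] {e : E} (he : ‖e‖ = 1) {n s : ℕ} (hs1 : 1 ≤ s) (hs : s ≤ n) {r : ℝ}
    (hr : ((s : ℝ) - 1) / 2 ≤ r) :
    ∃ c, (2 ^ n : ℝ)⁻¹ * largestBinomSum n s
      ≤ hitProb (fun _ : Fin n => e) Finset.univ c r := by
  set a := (n + 1 - s) / 2 with ha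
  refine ⟨((a : ℝ) + ((s : ℝ) - 1) / 2) • e, ?_⟩
  rw [hitProb, Finset.card_univ, Fintype.card_fin, div_eq_inv_mul]
  refine mul_le_mul_of_nonneg_left (Nat.cast_le.2 ?_) (by positivity)
  rw [largestBinomSum_eq_sum_centralWindow hs1 hs]
  have hsub : (centralWindow n s).biUnion (fun k => (Finset.univ : Finset (Fin n)).powersetCard k)
      ⊆ hits (fun _ : Fin n => e) Finset.univ (((a : ℝ) + ((s : ℝ) - 1) / 2) • e) r := by
    intro A hA
    obtain ⟨k, hk, hAk⟩ := Finset.mem_biUnion.1 hA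
    have hAk := (Finset.mem_powersetCard.1 hAk).2
    obtain ⟨h1, h2⟩ := Finset.mem_Ico.1 hk
    refine mem_hits.2 ⟨Finset.subset_univ _, ?_⟩
    rw [Finset.sum_const, hAk, ← Nat.cast_smul_eq_nsmul ℝ, ← sub_smul, norm_smul, he, mul_one]
    refine le_trans ?_ hr
    have h1' : (a : ℝ) ≤ k := by exact_mod_cast h1
    have h2' : (k : ℝ) + 1 ≤ a + s := by exact_mod_cast h2
    rw [Real.norm_eq_abs, abs_le]
    constructor <;> linarith
  refine le_trans (le_of_eq ?_) (Finset.card_le_card hsub)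
  rw [Finset.card_biUnion]
  · exact Finset.sum_congr rfl fun k _ => by simp
  · intro k _ l _ hkl
    exact Finset.pairwise_disjoint_powersetCard _ hkl

end LittlewoodOfford

theorem mainTheorem1 (d : ℕ) (hd : 1 ≤ d) (Δ : ℝ) (s : ℕ) (hs : s = ⌊Δ⌋₊ + 1)
    (hΔ₁ : (s : ℝ) - 1 ≤ Δ) (hΔ₂ : Δ < √(((s : ℝ) - 1) ^ 2 + 1)) :
    ∀ᶠ n : ℕ in atTop,
      LittlewoodOfford.smallBallProb d n Δ
        = ((2 : ℝ) ^ n)⁻¹ * (LittlewoodOfford.largestBinomSum n s : ℝ) := by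
  have hs1 : 1 ≤ s := by omega
  have hs1' : (1 : ℝ) ≤ s := by exact_mod_cast hs1
  have hΔ0 : 0 ≤ Δ := by linarith
  have hΔ : (2 * (Δ / 2)) ^ 2 < ((s : ℝ) - 1) ^ 2 + 1 := by
    rw [mul_div_cancel₀ _ two_ne_zero]
    exact (Real.lt_sqrt hΔ0).1 hΔ₂
  have : Nonempty (Fin d) := ⟨⟨0, hd⟩⟩
  obtain ⟨e, he⟩ := exists_norm_eq (EuclideanSpace ℝ (Fin d)) zero_le_one
  filter_upwards [LittlewoodOfford.eventually_hitProb_le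
    (E := EuclideanSpace ℝ (Fin d)) hs1 (by linarith) hΔ, eventually_ge_atTop s] with n hn hns
  have hub : ∀ p ∈ {p : ℝ | ∃ (v : Fin n → EuclideanSpace ℝ (Fin d))
      (x : EuclideanSpace ℝ (Fin d)), (∀ i, 1 ≤ ‖v i‖) ∧
        p = LittlewoodOfford.sumProb v (Metric.closedBall x Δ)},
      p ≤ ((2 : ℝ) ^ n)⁻¹ * (LittlewoodOfford.largestBinomSum n s : ℝ) := by
    rintro p ⟨v, x, hv, rfl⟩
    rw [LittlewoodOfford.sumProb_closedBall]
    exact hn v hv _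
  obtain ⟨c, hc⟩ := LittlewoodOfford.exists_largestBinomSum_le_hitProb he hs1 hns
    (r := Δ / 2) (by linarith)
  apply le_antisymm
  · exact csSup_le ⟨_, fun _ => e, 0, fun _ => he.ge, rfl⟩ hub
  · refine hc.trans (le_csSup ⟨_, hub⟩
      ⟨fun _ => e, (2 : ℝ) • c - ∑ _i : Fin n, e, fun _ => he.ge, ?_⟩)
    rw [LittlewoodOfford.sumProb_closedBall, sub_add_cancel, smul_smul,
      inv_mul_cancel₀ two_ne_zero, one_smul]
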